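/- **Setting.** Let $1\le K\le N$ be integers and let $\mathcal S$ be the collection of all $S\subseteq[N]$ with $1\le|S|\le K$. For $S\in\mathcal S$ and $v\in[0,1]^N$ let $\mu(S,v)$ be the distribution on $\{0,1,\dots,N\}$ with $\mu_i(S,v)=\frac{v_i}{1+\sum_{j\in S}v_j}$ for $i\in S$, $\mu_0(S,v)=\frac1{1+\sum_{j\in S}v_j}$, and $\mu_i(S,v)=0$ otherwise. For $r\in[0,1]^N$ let $R(S,v,r)=\sum_{i\in S}\mu_i(S,v)r_i$. For a context space $\mathcal X$ let $\mathcal F$ be a known class of functions $\mathcal X\to[0,1]^N$ containing an unknown $f^\star$ (realizability). The log loss of $f$ on $(x,S,i)$ is $-\log\mu_i(S,f(x))$. **Algorithm (parameter $\gamma>0$).** In each round $t=1,\dots,T$: an online regression oracle outputs $f_t:\mathcal X\to[0,1]^N$, based on the past triples $(x_s,S_s,i_s)$, $s<t$ (and possibly fresh randomness); an adversary provides a context $x_t\in\mathcal X$ and a reward vector $r_t\in[0,1]^N$, arbitrarily, possibly depending on everything that happened in the previous rounds; the learner computes $$q_t\in\operatorname*{argmax}_{q\in\Delta(\mathcal S)}\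 \sum_{S\in\mathcal S}q(S)R(S,f_t(x_t),r_t)-\frac{(K+1)^4}{\gamma}\sum_{i=1}^N\log\frac1{w_i(q)},\qquad w_i(q)=\sum_{S\ni i}q(S)$$ (ties broken by an arbitrary fixed rule depending on $(f_t(x_t),r_t)$), samples $S_t\sim q_t$, observes $i_t\sim\mu(S_t,f^\star(x_t))$, and feeds $(x_t,S_t,i_t)$ to the oracle. The regret is $$\mathbf{Reg}_{\mathsf{MNL}}=\mathbb E\Big[\sum_{t=1}^T\max_{S\in\mathcal S}R(S,f^\star(x_t),r_t)-\sum_{t=1}^TR(S_t,f^\star(x_t),r_t)\Big].$$ **Claim.** There is a universal constant $C>0$ such that the following two statements hold. 1. (Finite class, Hedge.) Let $\mathcal F$ be a finite class of functions $\mathcal X\to[\beta,1]^N$ with $\beta\in(0,1)$ and $|\mathcal F|\ge2$. Hedge keeps weights $p_t(f)\propto\exp\big(-\eta\sum_{s<t}-\log\mu_{i_s}(S_s,f(x_s))\big)$ on $\mathcal F$ with $\eta=\sqrt{\log|\mathcal F|/T}\,/\log(K/\beta)$; its predictor $f_t$ is either drawn at random from $p_t$, or is the average $\sum_{f\in\mathcal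 F}p_t(f)f$. There is a choice of $\gamma>0$, depending only on $N,K,T,\beta,|\mathcal F|$, for which, in either case and for every $\mathcal X$, $\mathcal F$, $f^\star\in\mathcal F$ and adversary, $$\mathbf{Reg}_{\mathsf{MNL}}\le C\,K^2\sqrt{N\log\tfrac K\beta}\;T^{3/4}(\log|\mathcal F|)^{1/4}.$$ 2. (Linear class, online gradient descent.) Let $B>0$, $d\ge0$, $\mathcal X\subseteq\{x\in\mathbb R^{d\times N}:\|x_i\|_2\le1\ \forall i\in[N]\}$, where $x_i$ is the $i$-th column of $x$, and $\mathcal F=\{f_\theta:\|\theta\|_2\le B\}$ with $f_{\theta,i}(x)=e^{\theta^\top x_i-B}$. Online gradient descent plays $f_t=f_{\theta_t}$, where $\theta_1$ is any point of the ball $\{\|\theta\|_2\le B\}$ and $\theta_{t+1}$ is the Euclidean projection onto this ball of $\theta_t-\eta\nabla_\theta\big(-\log\mu_{i_t}(S_t,f_\theta(x_t))\big)\big|_{\theta=\theta_t}$, with $\eta=B/\sqrt T$. There is a choice of $\gamma>0$, depending only on $N,K,T,B$ (in particular not on $d$), for which, for every $d$, $\mathcal X$, $f^\star\in\mathcal F$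 and adversary, $$\mathbf{Reg}_{\mathsf{MNL}}\le C\,K^2\sqrt{NB}\;T^{3/4}.$$ -/

import Mathlib

namespace MNLBandit

noncomputable section

/-- The assortments: subsets of the `N` items of size at least `1` and at most `K`. -/
abbrev Assortment (N K : ℕ) : Type :=
  {S : Finset (Fin N) // 1 ≤ S.card ∧ S.card ≤ K}

/-- The multinomial logit purchase probabilities `μ(S, v)`. The outcome `none` is "no purchase"
(whose value is `1`), the outcome `some i` is the purchase of item `i`. -/
def mnl {N : ℕ} (S : Finset (Fin N)) (v : Fin N → ℝ) : Option (Fin N) → ℝ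
  | none => 1 / (1 + ∑ j ∈ S, v j)
  | some i => if i ∈ S then v i / (1 + ∑ j ∈ S, v j) else 0

/-- The log loss of the predicted distribution `p` at the outcome `i`. -/
def logLoss {N : ℕ} (p : Option (Fin N) → ℝ) (i : Option (Fin N)) : ℝ :=
  -Real.log (p i)

/-- The expected reward `R(S, v, r)` of the assortment `S` (no purchase gives reward `0`). -/
def expReward {N : ℕ} (S : Finset (Fin N)) (v r : Fin N → ℝ) : ℝ :=
  ∑ i ∈ S, mnl S v (some i) * r i

/-- The largest expected reward of an assortment of size at most `K`. -/
def optReward {N : ℕ} (K : ℕ) (v r : Fin N → ℝ) : ℝ :=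
  ⨆ S : Assortment N K, expReward S.1 v r

/-- `w_i(q)`: the probability that the item `i` is in an assortment drawn from `q`. -/
def itemProb {N K : ℕ} (q : Assortment N K → ℝ) (i : Fin N) : ℝ :=
  ∑ S : Assortment N K, if i ∈ S.1 then q S else 0

/-- The log-barrier regularized expected reward of `q`. -/
def logBarrierObjective {N K : ℕ} (γ : ℝ) (v r : Fin N → ℝ) (q : Assortment N K → ℝ) : ℝ :=
  (∑ S : Assortment N K, q S * expReward S.1 v r)
    - ((K : ℝ) + 1) ^ 4 / γ * ∑ i : Fin N, Real.log (1 / itemProb q i)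

/-- `q` is a maximizer of the log-barrier objective over all distributions on assortments. A
distribution that misses an item has objective `-∞`, because `log (1 / 0) = +∞` there; so a
maximizer gives positive probability to every item, and is compared with such distributions. -/
def IsLogBarrierMaximizer {N K : ℕ} (γ : ℝ) (v r : Fin N → ℝ) (q : Assortment N K → ℝ) : Prop :=
  q ∈ stdSimplex ℝ (Assortment N K) ∧ (∀ i, 0 < itemProb q i) ∧
    ∀ q' ∈ stdSimplex ℝ (Assortment N K), (∀ i, 0 < itemProb q' i) →
      logBarrierObjective γ v r q' ≤ logBarrierObjective γ v r q

/-- The log-barrier strategy with parameter `γ`: for a predicted value vector `v` and a reward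
vector `r` it plays a maximizer `σ v r` of the log-barrier objective (ties broken arbitrarily). -/
def IsLogBarrierStrategy {N K : ℕ} (γ : ℝ)
    (σ : (Fin N → ℝ) → (Fin N → ℝ) → Assortment N K → ℝ) : Prop :=
  ∀ v r : Fin N → ℝ, (∀ i, v i ∈ Set.Icc (0 : ℝ) 1) → (∀ i, r i ∈ Set.Icc (0 : ℝ) 1) →
    IsLogBarrierMaximizer γ v r (σ v r)

/-- What is fed to the regression oracle after a round: context, assortment, purchase. -/
structure Observation (X : Type*) (N K : ℕ) where
  x : X
  S : Assortment N K
  i : Option (Fin N)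

/-- A full record of a round; `r` is the reward vector and `f` the predictor that was used. -/
structure Round (X : Type*) (N K : ℕ) extends Observation X N K where
  r : Fin N → ℝ
  f : X → Fin N → ℝ

/-- An online regression oracle: from the past observations (latest first) it makes an internal
random draw in `ι`, with probabilities `prob`, and outputs the predictor `predict`. For a
deterministic oracle `ι = Unit`. -/
structure OnlineOracle (ι X : Type*) (N K : ℕ) where
  prob : List (Observation X N K) → ι → ℝ
  predict : List (Observation X N K) → ι → X → Fin N → ℝ

section Hedge

variable {X : Type*} {N K : ℕ}

/-- Total log loss of the predictor `f` on the past observations. -/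
def cumLoss (f : X → Fin N → ℝ) (h : List (Observation X N K)) : ℝ :=
  (h.map fun o => logLoss (mnl o.S.1 (f o.x)) o.i).sum

/-- The exponential weights of Hedge with learning rate `η` on the finite class `F`. -/
def hedgeWeight (η : ℝ) (F : Finset (X → Fin N → ℝ)) (h : List (Observation X N K))
    (f : X → Fin N → ℝ) : ℝ :=
  Real.exp (-η * cumLoss f h) / ∑ g ∈ F, Real.exp (-η * cumLoss g h)

/-- Hedge whose predictor is drawn at random from its weights. -/
def hedgeSample (η : ℝ) (F : Finset (X → Fin N → ℝ)) : OnlineOracle F X N K where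
  prob h f := hedgeWeight η F h f.1
  predict _ f := f.1

/-- Hedge whose predictor is the weighted average of the class, a point of its convex hull. -/
def hedgeMean (η : ℝ) (F : Finset (X → Fin N → ℝ)) : OnlineOracle Unit X N K where
  prob _ _ := 1
  predict h _ := ∑ f ∈ F, hedgeWeight η F h f • f

end Hedge

section Linear

variable {d N K : ℕ}

/-- The value vector `f_θ(x)`, with `i`-th entry `exp (θᵀ x_i - B)`; a context is given by its
columns `x_1, …, x_N`. -/
def linearValue (B : ℝ) (θ : EuclideanSpace ℝ (Fin d)) (x : Fin N → EuclideanSpace ℝ (Fin d)) :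
    Fin N → ℝ :=
  fun i => Real.exp (inner ℝ θ (x i) - B)

/-- The linear class `{f_θ : ‖θ‖ ≤ B}` on the context space `X`. -/
def linearClass (B : ℝ) (X : Set (Fin N → EuclideanSpace ℝ (Fin d))) : Set (X → Fin N → ℝ) :=
  {f | ∃ θ : EuclideanSpace ℝ (Fin d), ‖θ‖ ≤ B ∧ f = fun x => linearValue B θ x.1}

/-- Euclidean projection onto the closed ball of radius `B` around the origin. -/
def projBall (B : ℝ) (θ : EuclideanSpace ℝ (Fin d)) : EuclideanSpace ℝ (Fin d) :=
  if ‖θ‖ ≤ B then θ else (B / ‖θ‖) • θ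

/-- The iterate of projected online gradient descent with step size `η` and initial point `θ₁`,
after the observations `h` (latest first). -/
def ogdIterate (η B : ℝ) (θ₁ : EuclideanSpace ℝ (Fin d))
    {X : Set (Fin N → EuclideanSpace ℝ (Fin d))} :
    List (Observation X N K) → EuclideanSpace ℝ (Fin d)
  | [] => θ₁
  | o :: h =>
    projBall B (ogdIterate η B θ₁ h -
      η • gradient (fun θ => logLoss (mnl o.S.1 (linearValue B θ o.x.1)) o.i)
        (ogdIterate η B θ₁ h))

/-- Online gradient descent as an online regression oracle for the linear class. -/
def ogd (η B : ℝ) (θ₁ : EuclideanSpace ℝ (Fin d))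
    (X : Set (Fin N → EuclideanSpace ℝ (Fin d))) : OnlineOracle Unit X N K where
  prob _ _ := 1
  predict h _ := fun x => linearValue B (ogdIterate η B θ₁ h) x.1

end Linear

section Interaction

variable {ι X : Type*} [Fintype ι] {N K : ℕ}

/-- An (adaptive) adversary: given everything that happened in the past rounds (latest first), it
chooses the next context and reward vector. -/
abbrev Adversary (X : Type*) (N K : ℕ) : Type _ :=
  List (Round X N K) → X × (Fin N → ℝ)

/-- The expectation of `G` (a function of the record of all rounds) when `n` more rounds are played
after the record `h`. In each round the oracle draws its predictor `f`, the adversary provides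
`(x, r)`, the learner draws `S` from `σ (f x) r`, the customer draws `i` from `μ(S, f⋆(x))`. -/
def expectation (O : OnlineOracle ι X N K)
    (σ : (Fin N → ℝ) → (Fin N → ℝ) → Assortment N K → ℝ) (fstar : X → Fin N → ℝ)
    (adv : Adversary X N K) (G : List (Round X N K) → ℝ) : ℕ → List (Round X N K) → ℝ
  | 0, h => G h
  | n + 1, h =>
    let obs := h.map Round.toObservation
    let x := (adv h).1
    let r := (adv h).2
    ∑ a : ι, O.prob obs a *
      ∑ S : Assortment N K, σ (O.predict obs a x) r S *
        ∑ i : Option (Fin N), mnl S.1 (fstar x) i *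
          expectation O σ fstar adv G n
            ({ x := x, S := S, i := i, r := r, f := O.predict obs a } :: h)

/-- The expected regret over `T` rounds against the best assortments in hindsight of `f⋆`. -/
def regret (O : OnlineOracle ι X N K)
    (σ : (Fin N → ℝ) → (Fin N → ℝ) → Assortment N K → ℝ) (fstar : X → Fin N → ℝ)
    (adv : Adversary X N K) (T : ℕ) : ℝ :=
  expectation O σ fstar adv
    (fun h => (h.map fun ρ =>
      optReward K (fstar ρ.x) ρ.r - expReward ρ.S.1 (fstar ρ.x) ρ.r).sum) T []

end Interaction

/-- The log-barrier objective always has a maximizer, so log-barrier strategies exist. -/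
theorem exists_isLogBarrierMaximizer {N K : ℕ} (hK : 1 ≤ K) (hKN : K ≤ N) {γ : ℝ} (hγ : 0 < γ)
    (v r : Fin N → ℝ) :
    ∃ q : Assortment N K → ℝ, IsLogBarrierMaximizer γ v r q := by
  classical
  set c : ℝ := ((K : ℝ) + 1) ^ 4 / γ with hc
  have hc0 : 0 < c := by positivity
  let W : (Assortment N K → ℝ) → ℝ := fun q => ∑ S : Assortment N K, q S * expReward S.1 v r
  let P : (Assortment N K → ℝ) → ℝ := fun q => Real.exp (W q) * ∏ i : Fin N, itemProb q i ^ c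
  have hw : ∀ i : Fin N, Continuous fun q : Assortment N K → ℝ => itemProb q i := by
    intro i
    unfold itemProb
    refine continuous_finsetSum _ fun S _ => ?_
    split_ifs <;> fun_prop
  have hP : Continuous P := by
    refine (Real.continuous_exp.comp (by fun_prop)).mul ?_
    exact continuous_finsetProd _ fun i _ =>
      (hw i).rpow_const fun _ => Or.inr hc0.le
  have hpos : ∀ q : Assortment N K → ℝ, (∀ i, 0 < itemProb q i) →
      0 < P q ∧ Real.log (P q) = logBarrierObjective γ v r q := by
    intro q hq
    have h1 : ∀ i : Fin N, 0 < itemProb q i ^ c := fun i => Real.rpow_pos_of_pos (hq i) _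
    refine ⟨mul_pos (Real.exp_pos _) (Finset.prod_pos fun i _ => h1 i), ?_⟩
    have h2 : Real.log (P q) = W q + ∑ i : Fin N, c * Real.log (itemProb q i) := by
      simp only [P]
      rw [Real.log_mul (Real.exp_pos _).ne' (Finset.prod_pos fun i _ => h1 i).ne', Real.log_exp,
        Real.log_prod fun i _ => (h1 i).ne']
      congr 1
      exact Finset.sum_congr rfl fun i _ => Real.log_rpow (hq i) _
    rw [h2]
    simp only [logBarrierObjective, one_div, Real.log_inv, Finset.sum_neg_distrib, ← Finset.mul_sum]
    simp only [W, ← hc]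
    ring
  have hnon : Nonempty (Assortment N K) :=
    ⟨⟨{⟨0, by omega⟩}, by simp, by simpa using hK⟩⟩
  let q₀ : Assortment N K → ℝ := fun _ => (Fintype.card (Assortment N K) : ℝ)⁻¹
  have hcard : (0 : ℝ) < Fintype.card (Assortment N K) := by exact_mod_cast Fintype.card_pos
  have hq₀ : q₀ ∈ stdSimplex ℝ (Assortment N K) := by
    refine ⟨fun _ => (inv_pos.mpr hcard).le, ?_⟩
    simp [q₀]
  have hq₀w : ∀ i, 0 < itemProb q₀ i := by
    intro i
    refine Finset.sum_pos' (fun S _ => ?_)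
      ⟨⟨{i}, by simp, by simpa using hK⟩, Finset.mem_univ _, ?_⟩
    · split_ifs
      · exact (inv_pos.mpr hcard).le
      · exact le_rfl
    · simpa [q₀] using hcard
  obtain ⟨q, hq, hmax⟩ :=
    (isCompact_stdSimplex ℝ (Assortment N K)).exists_isMaxOn ⟨q₀, hq₀⟩ hP.continuousOn
  have hPq : 0 < P q := (hpos q₀ hq₀w).1.trans_le (hmax hq₀)
  have hqw : ∀ i, 0 < itemProb q i := by
    intro i
    have h0 : 0 ≤ itemProb q i := by
      refine Finset.sum_nonneg fun S _ => ?_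
      split_ifs
      · exact hq.1 S
      · exact le_rfl
    refine lt_of_le_of_ne h0 fun h => ?_
    have : ∏ i : Fin N, itemProb q i ^ c = 0 :=
      Finset.prod_eq_zero (Finset.mem_univ i) (by rw [← h, Real.zero_rpow hc0.ne'])
    simp only [P, this, mul_zero] at hPq
    exact lt_irrefl _ hPq
  refine ⟨q, hq, hqw, fun q' hq' hq'w => ?_⟩
  rw [← (hpos q hqw).2, ← (hpos q' hq'w).2]
  exact Real.log_le_log (hpos q' hq'w).1 (hmax hq')

end

end MNLBandit

open MNLBandit

open MNLBandit
namespace MNLBandit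

/-! ### Multinomial choice: log loss, squared error and expected reward -/

section Choice

variable {N K : ℕ}

/-! The expected regret is traded for the excess log loss of the regression oracle, one round at a
time, and the excess log loss is then bounded by standard online learning.

Three facts about a single round are combined. Expected rewards are 1-Lipschitz in the values of the
offered items (`abs_expReward_sub_le`). Excess log loss controls the squared error of these values
up to a factor of order `K ^ 4` (`sum_sq_sub_le_logLoss`). First-order optimality of the log-barrier
maximizer charges an assortment `A` the price `∑ i ∈ A, c / w_i(q)` with `c = (K + 1) ^ 4 / γ`, at a
total cost of `c * N` (`IsLogBarrierMaximizer.expReward_sub_le`); rarely offered items are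
expensive, which pays for the poorly estimated values of the best assortment. If the predictor is
random, the error should be weighted with item probabilities independent of it;
`sum_optReward_sub_le` replaces `w_i(q_a)` by its average over the draw.

A round then costs at most `2 * c * N` plus `4 * γ` times the expected excess log loss. A potential
argument (`regret_le_of_step`, `regret_le_of_potential`) sums this along the adaptive interaction
without conditional expectations: the analyses of Hedge (`hedgePotential_cons_le`) and of gradient
descent (`ogd_potential_cons_le`) hold for every possible observation. With total excess loss `E`,
balancing `K ^ 4 * N * T / γ` against `γ * E` gives `K ^ 2 * √(N * T * E)`, and `E` of order `√T`
yields the exponent `3 / 4`.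

The log loss is not convex in the value vector, so for the averaged Hedge predictor Jensen is
applied to the squared error instead, and the loss analysis is still that of the whole weighted
class. -/

theorem one_le_one_add_sum {v : Fin N → ℝ} (hv : ∀ i, 0 ≤ v i) (S : Finset (Fin N)) :
    1 ≤ 1 + ∑ j ∈ S, v j :=
  le_add_of_nonneg_right (Finset.sum_nonneg fun i _ => hv i)

theorem one_add_sum_pos {v : Fin N → ℝ} (hv : ∀ i, 0 ≤ v i) (S : Finset (Fin N)) :
    0 < 1 + ∑ j ∈ S, v j :=
  one_pos.trans_le (one_le_one_add_sum hv S)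

theorem one_add_sum_le {v : Fin N → ℝ} (hv : ∀ i, v i ≤ 1) (S : Assortment N K) :
    1 + ∑ j ∈ S.1, v j ≤ (K : ℝ) + 1 := by
  have h1 : ∑ j ∈ S.1, v j ≤ ∑ _j ∈ S.1, (1 : ℝ) := Finset.sum_le_sum fun i _ => hv i
  have h2 : (S.1.card : ℝ) ≤ K := by exact_mod_cast S.2.2
  simp only [Finset.sum_const, nsmul_eq_mul, mul_one] at h1
  linarith

theorem mnl_nonneg {v : Fin N → ℝ} (hv : ∀ i, 0 ≤ v i) (S : Finset (Fin N)) (i : Option (Fin N)) :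
    0 ≤ mnl S v i := by
  have hZ := one_add_sum_pos hv S
  cases i with
  | none => simp only [mnl]; positivity
  | some i =>
    simp only [mnl]
    split_ifs
    · exact div_nonneg (hv i) hZ.le
    · exact le_rfl

theorem sum_mnl {v : Fin N → ℝ} (hv : ∀ i, 0 ≤ v i) (S : Finset (Fin N)) :
    ∑ i, mnl S v i = 1 := by
  have hZ := one_add_sum_pos hv S
  rw [Fintype.sum_option]
  simp only [mnl, Finset.sum_ite_mem, Finset.univ_inter, ← Finset.sum_div, ← add_div]
  exact div_self hZ.ne'

theorem mnl_le_one {v : Fin N → ℝ} (hv : ∀ i, 0 ≤ v i) (S : Finset (Fin N))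
    (i : Option (Fin N)) : mnl S v i ≤ 1 :=
  (Finset.single_le_sum (fun j _ => mnl_nonneg hv S j) (Finset.mem_univ i)).trans_eq (sum_mnl hv S)

/-- Both sides are compared with the Hellinger distance `∑ (√m - √p) ^ 2`. It is at most the
Kullback–Leibler divergence by `log x ≤ x - 1`, and `|m - p| = (√m + √p) |√m - √p|` with `√m + √p ≤
2` gives the factor 4. -/
theorem sum_sq_sub_le_kl {α : Type*} [Fintype α] {p m : α → ℝ} (hp : ∀ i, 0 ≤ p i)
    (hm : ∀ i, 0 ≤ m i) (hp1 : ∑ i, p i = 1) (hm1 : ∑ i, m i = 1) (hpm : ∀ i, 0 < p i → 0 < m i) :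
    ∑ i, (m i - p i) ^ 2 ≤ 4 * ∑ i, p i * (-Real.log (m i) - -Real.log (p i)) := by
  -- The correction `m i - p i` makes the inequality true termwise; it sums to zero.
  have hle : ∀ i, (m i - p i) ^ 2 ≤
      4 * (m i - p i + p i * (-Real.log (m i) - -Real.log (p i))) := by
    intro i
    have hpi : p i ≤ 1 :=
      (Finset.single_le_sum (fun j _ => hp j) (Finset.mem_univ i)).trans_eq hp1
    have hmi : m i ≤ 1 :=
      (Finset.single_le_sum (fun j _ => hm j) (Finset.mem_univ i)).trans_eq hm1
    have hkl : 2 * p i - 2 * (√(p i) * √(m i)) ≤ p i * (-Real.log (m i) - -Real.log (p i)) := by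
      rcases (hp i).eq_or_lt with h | h
      · simp [← h]
      · have hm' := hpm i h
        have hsp := Real.sqrt_pos.2 h
        have hsm := Real.sqrt_pos.2 hm'
        have h1 := Real.log_le_sub_one_of_pos (div_pos hsm hsp)
        rw [Real.log_div hsm.ne' hsp.ne', Real.log_sqrt hm'.le, Real.log_sqrt h.le] at h1
        have h2 : p i * (√(m i) / √(p i)) = √(p i) * √(m i) := by
          nth_rewrite 1 [← Real.mul_self_sqrt h.le]
          field_simp
        nlinarith [mul_le_mul_of_nonneg_left h1 h.le]
    obtain ⟨a, ha⟩ : ∃ a, a = √(p i) := ⟨_, rfl⟩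
    obtain ⟨b, hb⟩ : ∃ b, b = √(m i) := ⟨_, rfl⟩
    have ha0 : 0 ≤ a := ha ▸ Real.sqrt_nonneg _
    have hb0 : 0 ≤ b := hb ▸ Real.sqrt_nonneg _
    have ha1 : a ≤ 1 := ha ▸ Real.sqrt_le_one.2 hpi
    have hb1 : b ≤ 1 := hb ▸ Real.sqrt_le_one.2 hmi
    have hpa : p i = a ^ 2 := by rw [ha, Real.sq_sqrt (hp i)]
    have hmb : m i = b ^ 2 := by rw [hb, Real.sq_sqrt (hm i)]
    rw [← ha, ← hb] at hkl
    have h3 : (m i - p i) ^ 2 ≤ 4 * (b - a) ^ 2 := by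
      have : (m i - p i) ^ 2 = (a + b) ^ 2 * (b - a) ^ 2 := by rw [hpa, hmb]; ring
      rw [this]
      exact mul_le_mul_of_nonneg_right (by nlinarith) (sq_nonneg _)
    nlinarith
  calc ∑ i, (m i - p i) ^ 2
      ≤ ∑ i, 4 * (m i - p i + p i * (-Real.log (m i) - -Real.log (p i))) :=
        Finset.sum_le_sum fun i _ => hle i
    _ = _ := by
        rw [← Finset.mul_sum, Finset.sum_add_distrib, Finset.sum_sub_distrib, hp1, hm1]
        ring

/-- A value is the ratio of two purchase probabilities, `v i = μ_i / μ_0`, and `μ_0 ≥ 1 / (K + 1)`.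
So values depend stably on the choice distribution, whose squared error is controlled by the
divergence. -/
theorem sum_sq_sub_le_logLoss {v u : Fin N → ℝ} (hv : ∀ i, 0 < v i) (hv1 : ∀ i, v i ≤ 1)
    (hu : ∀ i, 0 ≤ u i) (hu1 : ∀ i, u i ≤ 1) (S : Assortment N K) :
    ∑ i ∈ S.1, (v i - u i) ^ 2 ≤ 8 * ((K : ℝ) + 1) ^ 4 *
      ∑ i, mnl S.1 u i * (logLoss (mnl S.1 v) i - logLoss (mnl S.1 u) i) := by
  have hv0 : ∀ i, 0 ≤ v i := fun i => (hv i).le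
  have hkl := sum_sq_sub_le_kl (mnl_nonneg hu S.1) (mnl_nonneg hv0 S.1) (sum_mnl hu S.1)
    (sum_mnl hv0 S.1) (by
      intro i hi
      cases i with
      | none => exact one_div_pos.2 (one_add_sum_pos hv0 S.1)
      | some i =>
        simp only [mnl] at hi ⊢
        split_ifs at hi ⊢
        · exact div_pos (hv i) (one_add_sum_pos hv0 S.1)
        · exact absurd hi (lt_irrefl _))
  set Z := 1 + ∑ j ∈ S.1, v j with hZ
  set Y := 1 + ∑ j ∈ S.1, u j with hY
  have hZ0 : 0 < Z := one_add_sum_pos hv0 S.1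
  have hY0 : 0 < Y := one_add_sum_pos hu S.1
  have hZK : Z ≤ (K : ℝ) + 1 := one_add_sum_le hv1 S
  have hYK : Y ≤ (K : ℝ) + 1 := one_add_sum_le hu1 S
  have hZY : (Z * Y) ^ 2 ≤ ((K : ℝ) + 1) ^ 4 := by
    calc (Z * Y) ^ 2 ≤ (((K : ℝ) + 1) * ((K : ℝ) + 1)) ^ 2 := by gcongr
      _ = _ := by ring
  have hterm : ∀ i ∈ S.1, (v i - u i) ^ 2 ≤ ((K : ℝ) + 1) ^ 4 *
      (2 * (mnl S.1 v (some i) - mnl S.1 u (some i)) ^ 2 +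
        2 * (mnl S.1 u (some i) * (mnl S.1 v none - mnl S.1 u none) ^ 2)) := by
    intro i hi
    have e : v i - u i = Z * Y * ((mnl S.1 v (some i) - mnl S.1 u (some i)) * mnl S.1 u none -
        mnl S.1 u (some i) * (mnl S.1 v none - mnl S.1 u none)) := by
      simp only [mnl, hi, if_true, ← hZ, ← hY]
      field_simp
      ring
    rw [e, mul_pow]
    have h1 := mnl_nonneg hu S.1 none
    have h2 := mnl_le_one hu S.1 none
    have h3 := mnl_nonneg hu S.1 (some i)
    have h4 := mnl_le_one hu S.1 (some i)
    refine mul_le_mul hZY ?_ (sq_nonneg _) (by positivity)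
    generalize mnl S.1 u none = a at *
    generalize mnl S.1 u (some i) = b at *
    generalize mnl S.1 v none - a = x
    generalize mnl S.1 v (some i) - b = y
    have ha : a ^ 2 ≤ 1 := pow_le_one₀ h1 h2
    -- Keeping `b` rather than bounding it by 1 saves a factor `K`: these probabilities sum to at
    -- most 1 over `S`.
    have hb : b ^ 2 ≤ b := by nlinarith
    nlinarith [sq_nonneg (y * a + b * x), mul_le_mul_of_nonneg_left ha (sq_nonneg y),
      mul_le_mul_of_nonneg_left hb (sq_nonneg x)]
  have hS : ∑ i ∈ S.1, mnl S.1 u (some i) ≤ 1 := by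
    rw [← sum_mnl hu S.1, Fintype.sum_option]
    have := Finset.sum_le_univ_sum_of_nonneg (s := S.1) fun i => mnl_nonneg hu S.1 (some i)
    linarith [mnl_nonneg hu S.1 none]
  have hS2 : ∑ i ∈ S.1, (mnl S.1 v (some i) - mnl S.1 u (some i)) ^ 2 +
      (mnl S.1 v none - mnl S.1 u none) ^ 2 ≤ ∑ i, (mnl S.1 v i - mnl S.1 u i) ^ 2 := by
    rw [Fintype.sum_option, add_comm]
    have := Finset.sum_le_univ_sum_of_nonneg (s := S.1)
      fun i => sq_nonneg (mnl S.1 v (some i) - mnl S.1 u (some i))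
    linarith
  calc ∑ i ∈ S.1, (v i - u i) ^ 2
      ≤ ∑ i ∈ S.1, ((K : ℝ) + 1) ^ 4 *
        (2 * (mnl S.1 v (some i) - mnl S.1 u (some i)) ^ 2 +
          2 * (mnl S.1 u (some i) * (mnl S.1 v none - mnl S.1 u none) ^ 2)) :=
        Finset.sum_le_sum hterm
    _ = ((K : ℝ) + 1) ^ 4 * (2 * ∑ i ∈ S.1, (mnl S.1 v (some i) - mnl S.1 u (some i)) ^ 2 +
          2 * ((∑ i ∈ S.1, mnl S.1 u (some i)) * (mnl S.1 v none - mnl S.1 u none) ^ 2)) := by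
        rw [← Finset.mul_sum, Finset.sum_add_distrib, ← Finset.mul_sum, ← Finset.mul_sum,
          ← Finset.sum_mul]
    _ ≤ ((K : ℝ) + 1) ^ 4 * (2 * (4 *
          ∑ i, mnl S.1 u i * (logLoss (mnl S.1 v) i - logLoss (mnl S.1 u) i))) := by
        refine mul_le_mul_of_nonneg_left ?_ (by positivity)
        have := mul_le_mul_of_nonneg_right hS (sq_nonneg (mnl S.1 v none - mnl S.1 u none))
        simp only [logLoss]
        linarith
    _ = _ := by ring

theorem expReward_mem_Icc {v r : Fin N → ℝ} (hv : ∀ i, 0 ≤ v i)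
    (hr : ∀ i, r i ∈ Set.Icc (0 : ℝ) 1) (S : Finset (Fin N)) :
    expReward S v r ∈ Set.Icc (0 : ℝ) 1 := by
  refine ⟨Finset.sum_nonneg fun i _ => mul_nonneg (mnl_nonneg hv S _) (hr i).1, ?_⟩
  calc expReward S v r ≤ ∑ i ∈ S, mnl S v (some i) :=
        Finset.sum_le_sum fun i _ => mul_le_of_le_one_right (mnl_nonneg hv S _) (hr i).2
    _ ≤ ∑ i, mnl S v (some i) :=
        Finset.sum_le_univ_sum_of_nonneg fun i => mnl_nonneg hv S (some i)
    _ ≤ ∑ i, mnl S v i := by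
        rw [Fintype.sum_option]
        linarith [mnl_nonneg hv S none]
    _ = 1 := sum_mnl hv S

theorem expReward_eq_div (S : Finset (Fin N)) (v r : Fin N → ℝ) :
    expReward S v r = (∑ i ∈ S, v i * r i) / (1 + ∑ j ∈ S, v j) := by
  rw [expReward, Finset.sum_div]
  refine Finset.sum_congr rfl fun i hi => ?_
  simp only [mnl, hi, if_true]
  ring

theorem abs_expReward_sub_le {v u r : Fin N → ℝ} (hv : ∀ i, 0 ≤ v i) (hu : ∀ i, 0 ≤ u i)
    (hr : ∀ i, r i ∈ Set.Icc (0 : ℝ) 1) (S : Finset (Fin N)) :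
    |expReward S v r - expReward S u r| ≤ ∑ i ∈ S, |v i - u i| := by
  have hR := expReward_mem_Icc hu hr S
  have hZ := one_add_sum_pos hv S
  have hY := one_add_sum_pos hu S
  -- Centering the rewards at `expReward S u r` absorbs the change of the normalizer, and centered
  -- rewards still lie in `[-1, 1]`.
  have e : expReward S v r - expReward S u r =
      (∑ i ∈ S, (v i - u i) * (r i - expReward S u r)) / (1 + ∑ j ∈ S, v j) := by
    have h1 : ∑ i ∈ S, (v i - u i) * (r i - expReward S u r) =
        (∑ i ∈ S, v i * r i) - (∑ i ∈ S, u i * r i) -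
          ((∑ i ∈ S, v i) - ∑ i ∈ S, u i) * expReward S u r := by
      simp only [← Finset.sum_sub_distrib, Finset.sum_mul]
      exact Finset.sum_congr rfl fun i _ => by ring
    rw [h1, expReward_eq_div S v r, expReward_eq_div S u r]
    field_simp
    ring
  rw [e, abs_div, abs_of_pos hZ]
  refine (div_le_self (abs_nonneg _) (one_le_one_add_sum hv S)).trans ?_
  refine (Finset.abs_sum_le_sum_abs _ _).trans (Finset.sum_le_sum fun i _ => ?_)
  rw [abs_mul]
  refine mul_le_of_le_one_right (abs_nonneg _) (abs_le.2 ⟨?_, ?_⟩)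
  · linarith [(hr i).1, hR.2]
  · linarith [(hr i).2, hR.1]

end Choice

/-! ### Optimality of the log-barrier strategy and its regret in one round -/

section LogBarrier

variable {N K : ℕ}

theorem itemProb_le_one {q : Assortment N K → ℝ} (hq : q ∈ stdSimplex ℝ (Assortment N K))
    (i : Fin N) : itemProb q i ≤ 1 := by
  rw [← hq.2]
  refine Finset.sum_le_sum fun S _ => ?_
  split_ifs
  · exact le_rfl
  · exact hq.1 S

theorem sum_itemProb_mul (q : Assortment N K → ℝ) (z : Fin N → ℝ) :
    ∑ i, itemProb q i * z i = ∑ S, q S * ∑ i ∈ S.1, z i := by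
  simp only [itemProb, Finset.sum_mul, Finset.mul_sum]
  rw [Finset.sum_comm]
  refine Finset.sum_congr rfl fun S _ => ?_
  simp [ite_mul, Finset.sum_ite_mem]

/-- First-order optimality of a log-barrier maximizer in the direction of a single assortment. -/
theorem IsLogBarrierMaximizer.expReward_sub_le {γ : ℝ} (hγ : 0 < γ) {v r : Fin N → ℝ}
    {q : Assortment N K → ℝ} (hq : IsLogBarrierMaximizer γ v r q) (A : Assortment N K) :
    expReward A.1 v r - ∑ S, q S * expReward S.1 v r ≤
      ((K : ℝ) + 1) ^ 4 / γ * N - ∑ i ∈ A.1, ((K : ℝ) + 1) ^ 4 / γ / itemProb q i := by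
  classical
  obtain ⟨hqs, hw, hmax⟩ := hq
  set c : ℝ := ((K : ℝ) + 1) ^ 4 / γ with hc
  have hc0 : 0 < c := by positivity
  set D : ℝ := expReward A.1 v r - ∑ S, q S * expReward S.1 v r with hD
  -- Relative rate of change of the probability of item `i` when mass moves from `q` to the vertex
  -- `A`.
  let a : Fin N → ℝ := fun i => (if i ∈ A.1 then 1 else 0) / itemProb q i - 1
  have ha : ∀ i, -1 ≤ a i := by
    intro i
    have : 0 ≤ (if i ∈ A.1 then (1 : ℝ) else 0) / itemProb q i :=
      div_nonneg (by split_ifs <;> norm_num) (hw i).le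
    simp only [a]
    linarith
  have key : ∀ ε ∈ Set.Ioo (0 : ℝ) 1, D + c * ∑ i, a i / (1 + ε * a i) ≤ 0 := by
    rintro ε ⟨hε0, hε1⟩
    let q' : Assortment N K → ℝ := fun S => (1 - ε) * q S + ε * Pi.single (M := fun _ => ℝ) A 1 S
    have hq' : q' ∈ stdSimplex ℝ (Assortment N K) :=
      convex_stdSimplex ℝ (Assortment N K) hqs (single_mem_stdSimplex ℝ A)
        (by linarith) hε0.le (by ring)
    have hpos : ∀ i, 0 < 1 + ε * a i := fun i => by nlinarith [ha i]
    have hw' : ∀ i, itemProb q' i = itemProb q i * (1 + ε * a i) := by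
      intro i
      have h1 : itemProb q' i = (1 - ε) * itemProb q i + ε * (if i ∈ A.1 then 1 else 0) := by
        have h2 : (∑ S : Assortment N K, if i ∈ S.1 then
            (Pi.single (M := fun _ => ℝ) A 1 S) else 0) = if i ∈ A.1 then 1 else 0 := by
          rw [Finset.sum_eq_single A]
          · simp
          · intro S _ hS; simp [Pi.single_eq_of_ne hS]
          · simp
        rw [← h2]
        simp only [itemProb, Finset.mul_sum, ← Finset.sum_add_distrib, q']
        refine Finset.sum_congr rfl fun S _ => ?_
        split_ifs <;> ring
      have := (hw i).ne'
      rw [h1]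
      simp only [a]
      field_simp
      ring
    have h := hmax q' hq' fun i => by rw [hw' i]; exact mul_pos (hw i) (hpos i)
    have hR : ∑ S, q' S * expReward S.1 v r =
        ∑ S, q S * expReward S.1 v r + ε * D := by
      have h2 : ∑ S : Assortment N K, (Pi.single (M := fun _ => ℝ) A 1 S) * expReward S.1 v r =
          expReward A.1 v r := by
        rw [Finset.sum_eq_single A]
        · simp
        · intro S _ hS; simp [Pi.single_eq_of_ne hS]
        · simp
      rw [hD, ← h2, mul_sub, Finset.mul_sum, Finset.mul_sum, ← Finset.sum_sub_distrib,
        ← Finset.sum_add_distrib]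
      refine Finset.sum_congr rfl fun S _ => ?_
      simp only [q']
      ring
    have hL : ∑ i, Real.log (1 / itemProb q' i) =
        ∑ i, Real.log (1 / itemProb q i) - ∑ i, Real.log (1 + ε * a i) := by
      rw [← Finset.sum_sub_distrib]
      refine Finset.sum_congr rfl fun i _ => ?_
      rw [hw' i, one_div, one_div, Real.log_inv, Real.log_inv,
        Real.log_mul (hw i).ne' (hpos i).ne']
      ring
    simp only [logBarrierObjective] at h
    rw [hR, hL, ← hc] at h
    -- The bound `log (1 + x) ≥ x / (1 + x)` makes the comparison divisible by `ε`, so that letting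
    -- `ε` tend to 0 replaces differentiating the objective.
    have h3 : ε * (D + c * ∑ i, a i / (1 + ε * a i)) ≤
        ε * D + c * ∑ i, Real.log (1 + ε * a i) := by
      rw [mul_add, mul_left_comm]
      gcongr
      rw [Finset.mul_sum]
      refine Finset.sum_le_sum fun i _ => ?_
      have h4 := Real.one_sub_inv_le_log_of_pos (hpos i)
      refine le_trans (le_of_eq ?_) h4
      have := (hpos i).ne'
      field_simp
      ring
    have h5 : ε * (D + c * ∑ i, a i / (1 + ε * a i)) ≤ 0 := by linarith
    exact nonpos_of_mul_nonpos_right h5 hε0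
  have hlim : Filter.Tendsto (fun ε : ℝ => D + c * ∑ i, a i / (1 + ε * a i))
      (nhdsWithin 0 (Set.Ioi 0)) (nhds (D + c * ∑ i, a i / (1 + 0 * a i))) := by
    have : ContinuousAt (fun ε : ℝ => D + c * ∑ i, a i / (1 + ε * a i)) 0 := by
      refine continuousAt_const.add (continuousAt_const.mul ?_)
      refine tendsto_finsetSum _ fun i _ => ?_
      exact ContinuousAt.div (by fun_prop) (by fun_prop) (by simp)
    exact this.tendsto.mono_left nhdsWithin_le_nhds
  have hfin := le_of_tendsto hlim
    (Filter.eventually_of_mem (Ioo_mem_nhdsGT one_pos) key)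
  have hsum : c * ∑ i, a i / (1 + 0 * a i) = ∑ i ∈ A.1, c / itemProb q i - c * N := by
    have h : ∀ i, a i / (1 + 0 * a i) = (if i ∈ A.1 then 1 / itemProb q i else 0) - 1 := by
      intro i
      simp only [zero_mul, add_zero, div_one, a, ite_div, zero_div]
    simp only [h, Finset.sum_sub_distrib, Finset.sum_ite_mem, Finset.univ_inter, mul_sub,
      Finset.mul_sum, mul_one_div, Finset.sum_const, Finset.card_univ, Fintype.card_fin,
      nsmul_eq_mul, mul_one]
  linarith

/-- The regret of the log-barrier strategy in one round, when the predictor is drawn from a finite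
family, is controlled by the squared errors weighted with the average item probabilities: the
predictor in the error term is independent of the assortment. -/
theorem sum_optReward_sub_le (hK : 1 ≤ K) (hKN : K ≤ N) {γ : ℝ} (hγ : 0 < γ)
    {ι : Type*} [Fintype ι] {p : ι → ℝ} (hp : ∀ a, 0 ≤ p a) (hp1 : ∑ a, p a = 1)
    {v : ι → Fin N → ℝ} {u r : Fin N → ℝ} (hv : ∀ a i, 0 ≤ v a i) (hu : ∀ i, 0 ≤ u i)
    (hr : ∀ i, r i ∈ Set.Icc (0 : ℝ) 1) {q : ι → Assortment N K → ℝ}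
    (hq : ∀ a, IsLogBarrierMaximizer γ (v a) r (q a)) :
    ∑ a, p a * ∑ S, q a S * (optReward K u r - expReward S.1 u r) ≤
      2 * (((K : ℝ) + 1) ^ 4 / γ) * N + γ / (2 * ((K : ℝ) + 1) ^ 4) *
        ∑ a, p a * ∑ b, p b * ∑ S, q b S * ∑ i ∈ S.1, (v a i - u i) ^ 2 := by
  set c : ℝ := ((K : ℝ) + 1) ^ 4 / γ with hc
  have hc0 : 0 < c := by positivity
  have hcγ : γ / (2 * ((K : ℝ) + 1) ^ 4) = 1 / (2 * c) := by rw [hc]; field_simp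
  have : Nonempty (Assortment N K) := ⟨⟨{⟨0, by omega⟩}, by simp, by simpa using hK⟩⟩
  obtain ⟨A, hA⟩ := exists_eq_ciSup_of_finite (f := fun S : Assortment N K => expReward S.1 u r)
  -- Averaged over the draw of the predictor, hence independent of the index `a` in the error term.
  let w : Fin N → ℝ := fun i => ∑ a, p a * itemProb (q a) i
  have hw : ∀ i, 0 < w i := by
    intro i
    obtain ⟨a, ha⟩ : ∃ a, p a ≠ 0 := by
      by_contra! h
      simp [h] at hp1
    exact Finset.sum_pos' (fun a _ => mul_nonneg (hp a) ((hq a).2.1 i).le)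
      ⟨a, Finset.mem_univ _, mul_pos ((hp a).lt_of_ne' ha) ((hq a).2.1 i)⟩
  have hround : ∀ a, ∑ S, q a S * (optReward K u r - expReward S.1 u r) ≤
      c * N + (∑ i ∈ A.1, (c * itemProb (q a) i / w i ^ 2 - c / w i +
          w i * (v a i - u i) ^ 2 / (4 * c)) +
        ∑ i, (c * itemProb (q a) i / w i + w i * (v a i - u i) ^ 2 / (4 * c))) := by
    intro a
    have h1 := (hq a).expReward_sub_le hγ A
    rw [← hc] at h1
    have h2 := (abs_le.1 (abs_expReward_sub_le hu (hv a) hr A.1)).2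
    have h3 : ∑ S, q a S * expReward S.1 (v a) r - ∑ S, q a S * expReward S.1 u r ≤
        ∑ i, itemProb (q a) i * |u i - v a i| := by
      rw [sum_itemProb_mul, ← Finset.sum_sub_distrib]
      refine Finset.sum_le_sum fun S _ => ?_
      rw [← mul_sub]
      refine mul_le_mul_of_nonneg_left ?_ ((hq a).1.1 S)
      linarith [(abs_le.1 (abs_expReward_sub_le hu (hv a) hr S.1)).1]
    have h4 : ∑ S, q a S * (optReward K u r - expReward S.1 u r) =
        expReward A.1 u r - ∑ S, q a S * expReward S.1 u r := by
      simp only [mul_sub, Finset.sum_sub_distrib, ← Finset.sum_mul, (hq a).1.2, one_mul]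
      rw [optReward, ← hA]
    -- With `y = w_i(q_a)` and `x = w i`, the concave function `-c / y` lies below its tangent at
    -- `x`, which is `c * y / x ^ 2 - 2 * c / x`. AM-GM bounds the error by `c / x + x * z ^ 2 / (4
    -- * c)`. What remains besides the squared error is linear in `y` and vanishes on average.
    have h5 : ∑ i ∈ A.1, (|u i - v a i| - c / itemProb (q a) i) ≤
        ∑ i ∈ A.1, (c * itemProb (q a) i / w i ^ 2 - c / w i +
          w i * (v a i - u i) ^ 2 / (4 * c)) := by
      refine Finset.sum_le_sum fun i _ => ?_
      have hy := (hq a).2.1 i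
      have hx := hw i
      rw [← sq_abs (v a i - u i), abs_sub_comm (v a i)]
      generalize itemProb (q a) i = y at *
      generalize w i = x at *
      generalize |u i - v a i| = z
      have e1 : c * y / x ^ 2 + c / y - 2 * (c / x) = c * (x - y) ^ 2 / (x ^ 2 * y) := by
        field_simp
        ring
      have e2 : c / x + x * z ^ 2 / (4 * c) - z = (2 * c - x * z) ^ 2 / (4 * c * x) := by
        field_simp
        ring
      have e3 : 0 ≤ c * (x - y) ^ 2 / (x ^ 2 * y) := by positivity
      have e4 : 0 ≤ (2 * c - x * z) ^ 2 / (4 * c * x) := by positivity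
      linarith
    -- AM-GM again, with `y ^ 2 ≤ y` so that the first term is linear in `y` and averages to `c` for
    -- each item.
    have h6 : ∑ i, itemProb (q a) i * |u i - v a i| ≤
        ∑ i, (c * itemProb (q a) i / w i + w i * (v a i - u i) ^ 2 / (4 * c)) := by
      refine Finset.sum_le_sum fun i _ => ?_
      have hy := (hq a).2.1 i
      have hx := hw i
      have hy1 := itemProb_le_one (hq a).1 i
      rw [← sq_abs (v a i - u i), abs_sub_comm (v a i)]
      generalize itemProb (q a) i = y at *
      generalize w i = x at *
      generalize |u i - v a i| = z
      have e2 : c * (y * y) / x + x * z ^ 2 / (4 * c) - y * z =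
          (2 * c * y - x * z) ^ 2 / (4 * c * x) := by
        field_simp
        ring
      have e4 : 0 ≤ (2 * c * y - x * z) ^ 2 / (4 * c * x) := by positivity
      have e5 : c * (y * y) / x ≤ c * y / x := by gcongr; nlinarith
      linarith
    rw [Finset.sum_sub_distrib] at h5
    linarith
  have havg : ∀ i, ∑ a, p a * (c * itemProb (q a) i / w i) = c := by
    intro i
    have : ∑ a, p a * (c * itemProb (q a) i / w i) = c / w i * w i := by
      simp only [w, Finset.mul_sum]
      exact Finset.sum_congr rfl fun a _ => by ring
    rw [this, div_mul_cancel₀ _ (hw i).ne']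
  have herr : ∑ a, p a * ∑ b, p b * ∑ S, q b S * ∑ i ∈ S.1, (v a i - u i) ^ 2 =
      ∑ i, ∑ a, p a * (w i * (v a i - u i) ^ 2) := by
    rw [Finset.sum_comm]
    refine Finset.sum_congr rfl fun a _ => ?_
    simp only [← sum_itemProb_mul, ← Finset.mul_sum]
    congr 1
    simp only [w, Finset.sum_mul, Finset.mul_sum]
    rw [Finset.sum_comm]
    exact Finset.sum_congr rfl fun b _ => Finset.sum_congr rfl fun i _ => by ring
  set E : Fin N → ℝ := fun i => ∑ a, p a * (w i * (v a i - u i) ^ 2) with hE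
  have hE0 : ∀ i, 0 ≤ E i := fun i =>
    Finset.sum_nonneg fun a _ => mul_nonneg (hp a) (mul_nonneg (hw i).le (sq_nonneg _))
  have hdiv : ∀ i, ∑ a, p a * (w i * (v a i - u i) ^ 2 / (4 * c)) = E i / (4 * c) := by
    intro i
    rw [hE, Finset.sum_div]
    exact Finset.sum_congr rfl fun a _ => by ring
  calc ∑ a, p a * ∑ S, q a S * (optReward K u r - expReward S.1 u r)
      ≤ ∑ a, p a * (c * N + (∑ i ∈ A.1, (c * itemProb (q a) i / w i ^ 2 - c / w i +
          w i * (v a i - u i) ^ 2 / (4 * c)) +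
        ∑ i, (c * itemProb (q a) i / w i + w i * (v a i - u i) ^ 2 / (4 * c)))) :=
        Finset.sum_le_sum fun a _ => mul_le_mul_of_nonneg_left (hround a) (hp a)
    _ = c * N + (∑ i ∈ A.1, E i / (4 * c) + ∑ i, (c + E i / (4 * c))) := by
        have hswap : ∀ (s : Finset (Fin N)) (g : ι → Fin N → ℝ),
            ∑ a, p a * ∑ i ∈ s, g a i = ∑ i ∈ s, ∑ a, p a * g a i := by
          intro s g
          simp only [Finset.mul_sum]
          rw [Finset.sum_comm]
        simp only [mul_add (p _), Finset.sum_add_distrib, ← Finset.sum_mul, hp1, one_mul, hswap]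
        have h1 : ∀ i, ∑ a, p a * (c * itemProb (q a) i / w i ^ 2 - c / w i) = 0 := by
          intro i
          have h2 : ∑ a, p a * (c * itemProb (q a) i / w i ^ 2) = c / w i := by
            refine Eq.trans ?_ (congrArg (· / w i) (havg i))
            simp only [Finset.sum_div]
            exact Finset.sum_congr rfl fun a _ => by ring
          simp only [mul_sub, Finset.sum_sub_distrib, ← Finset.sum_mul, hp1, h2]
          ring
        simp only [h1, havg, hdiv, Finset.sum_const_zero, zero_add]
    -- The errors of the items in the optimal `A` are enlarged to those of all items.
    _ ≤ c * N + (∑ i, E i / (4 * c) + ∑ i, (c + E i / (4 * c))) := by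
        gcongr
        · intro i _ _
          exact div_nonneg (hE0 i) (by positivity)
        · exact Finset.subset_univ _
    _ = _ := by
        rw [herr, hcγ, Finset.sum_add_distrib, ← Finset.sum_div]
        simp only [Finset.sum_const, Finset.card_univ, Fintype.card_fin, nsmul_eq_mul]
        field_simp
        ring

end LogBarrier

/-! ### From one round to the whole interaction -/

section Potential

variable {ι κ X : Type*} [Fintype ι] [Fintype κ] {N K : ℕ}

/-- The regret of the log-barrier strategy in one round, bounded by the excess log loss of a finite
family of predictors `y` with weights `π` whose squared errors dominate those of the predictors
`v` that are used. -/
theorem sum_optReward_sub_le_logLoss (hK : 1 ≤ K) (hKN : K ≤ N) {γ : ℝ} (hγ : 0 < γ)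
    {p : ι → ℝ} (hp : ∀ a, 0 ≤ p a) (hp1 : ∑ a, p a = 1)
    {v : ι → Fin N → ℝ} {u r : Fin N → ℝ} (hv : ∀ a i, 0 ≤ v a i) (hu : ∀ i, 0 ≤ u i)
    (hu1 : ∀ i, u i ≤ 1) (hr : ∀ i, r i ∈ Set.Icc (0 : ℝ) 1) {q : ι → Assortment N K → ℝ}
    (hq : ∀ a, IsLogBarrierMaximizer γ (v a) r (q a))
    {π : κ → ℝ} (hπ : ∀ k, 0 ≤ π k) {y : κ → Fin N → ℝ} (hy : ∀ k i, 0 < y k i)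
    (hy1 : ∀ k i, y k i ≤ 1)
    (hvy : ∀ i, ∑ a, p a * (v a i - u i) ^ 2 ≤ ∑ k, π k * (y k i - u i) ^ 2) :
    ∑ a, p a * ∑ S, q a S * (optReward K u r - expReward S.1 u r) ≤
      2 * (((K : ℝ) + 1) ^ 4 / γ) * N + 4 * γ * ∑ a, p a * ∑ S, q a S * ∑ i, mnl S.1 u i *
        ∑ k, π k * (logLoss (mnl S.1 (y k)) i - logLoss (mnl S.1 u) i) := by
  refine (sum_optReward_sub_le hK hKN hγ hp hp1 hv hu hr hq).trans ?_
  have h1 : ∑ a, p a * ∑ b, p b * ∑ S, q b S * ∑ i ∈ S.1, (v a i - u i) ^ 2 =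
      ∑ b, p b * ∑ S, q b S * ∑ i ∈ S.1, ∑ a, p a * (v a i - u i) ^ 2 := by
    simp only [Finset.mul_sum]
    rw [Finset.sum_comm]
    refine Finset.sum_congr rfl fun b _ => ?_
    rw [Finset.sum_comm]
    refine Finset.sum_congr rfl fun S _ => ?_
    rw [Finset.sum_comm]
    exact Finset.sum_congr rfl fun i _ => Finset.sum_congr rfl fun a _ => by ring
  have h2 : ∀ S : Assortment N K, ∑ i ∈ S.1, ∑ a, p a * (v a i - u i) ^ 2 ≤
      8 * ((K : ℝ) + 1) ^ 4 * ∑ i, mnl S.1 u i *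
        ∑ k, π k * (logLoss (mnl S.1 (y k)) i - logLoss (mnl S.1 u) i) := by
    intro S
    calc ∑ i ∈ S.1, ∑ a, p a * (v a i - u i) ^ 2
        ≤ ∑ i ∈ S.1, ∑ k, π k * (y k i - u i) ^ 2 := Finset.sum_le_sum fun i _ => hvy i
      _ = ∑ k, π k * ∑ i ∈ S.1, (y k i - u i) ^ 2 := by
          rw [Finset.sum_comm]
          simp only [Finset.mul_sum]
      _ ≤ ∑ k, π k * (8 * ((K : ℝ) + 1) ^ 4 *
            ∑ i, mnl S.1 u i * (logLoss (mnl S.1 (y k)) i - logLoss (mnl S.1 u) i)) :=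
          Finset.sum_le_sum fun k _ => mul_le_mul_of_nonneg_left
            (sum_sq_sub_le_logLoss (hy k) (hy1 k) hu hu1 S) (hπ k)
      _ = _ := by
          simp only [Finset.mul_sum]
          rw [Finset.sum_comm]
          exact Finset.sum_congr rfl fun i _ => Finset.sum_congr rfl fun k _ => by ring
  have h3 : ∑ b, p b * ∑ S, q b S * ∑ i ∈ S.1, ∑ a, p a * (v a i - u i) ^ 2 ≤
      8 * ((K : ℝ) + 1) ^ 4 * ∑ b, p b * ∑ S, q b S * ∑ i, mnl S.1 u i *
        ∑ k, π k * (logLoss (mnl S.1 (y k)) i - logLoss (mnl S.1 u) i) := by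
    rw [Finset.mul_sum]
    refine Finset.sum_le_sum fun b _ => ?_
    rw [mul_left_comm]
    refine mul_le_mul_of_nonneg_left ?_ (hp b)
    rw [Finset.mul_sum]
    refine Finset.sum_le_sum fun S _ => ?_
    rw [mul_left_comm]
    exact mul_le_mul_of_nonneg_left (h2 S) ((hq b).1.1 S)
  rw [h1]
  refine add_le_add le_rfl ((mul_le_mul_of_nonneg_left h3 (by positivity)).trans_eq ?_)
  field_simp
  ring

theorem sum_round_add (p : ι → ℝ) (q : ι → Assortment N K → ℝ) (u : Fin N → ℝ)
    (g₁ g₂ : ι → Assortment N K → Option (Fin N) → ℝ) :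
    ∑ a, p a * ∑ S, q a S * ∑ i, mnl S.1 u i * (g₁ a S i + g₂ a S i) =
      ∑ a, p a * ∑ S, q a S * ∑ i, mnl S.1 u i * g₁ a S i +
        ∑ a, p a * ∑ S, q a S * ∑ i, mnl S.1 u i * g₂ a S i := by
  simp only [mul_add, Finset.sum_add_distrib]

theorem sum_round_const {p : ι → ℝ} (hp1 : ∑ a, p a = 1) {q : ι → Assortment N K → ℝ}
    (hq1 : ∀ a, ∑ S, q a S = 1) {u : Fin N → ℝ} (hu : ∀ i, 0 ≤ u i) (z : ℝ) :
    ∑ a, p a * ∑ S, q a S * ∑ i, mnl S.1 u i * z = z := by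
  simp only [← Finset.sum_mul, sum_mnl hu, hq1, hp1, one_mul]

theorem sum_round_mono {p : ι → ℝ} (hp : ∀ a, 0 ≤ p a) {q : ι → Assortment N K → ℝ}
    (hq : ∀ a S, 0 ≤ q a S) {u : Fin N → ℝ} (hu : ∀ i, 0 ≤ u i)
    {g₁ g₂ : ι → Assortment N K → Option (Fin N) → ℝ} (hg : ∀ a S i, g₁ a S i ≤ g₂ a S i) :
    ∑ a, p a * ∑ S, q a S * ∑ i, mnl S.1 u i * g₁ a S i ≤
      ∑ a, p a * ∑ S, q a S * ∑ i, mnl S.1 u i * g₂ a S i := by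
  refine Finset.sum_le_sum fun a _ => mul_le_mul_of_nonneg_left ?_ (hp a)
  refine Finset.sum_le_sum fun S _ => mul_le_mul_of_nonneg_left ?_ (hq a S)
  exact Finset.sum_le_sum fun i _ => mul_le_mul_of_nonneg_left (hg a S i) (mnl_nonneg hu _ _)

/-- Potential argument for the expected regret: it suffices to bound the regret plus the growth of
a nonnegative potential in each round. -/
theorem regret_le_of_step {O : OnlineOracle ι X N K}
    {σ : (Fin N → ℝ) → (Fin N → ℝ) → Assortment N K → ℝ} {fstar : X → Fin N → ℝ}
    {adv : Adversary X N K} (hf : ∀ x i, 0 ≤ fstar x i)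
    (hO : ∀ h a, 0 ≤ O.prob h a) (hO1 : ∀ h, ∑ a, O.prob h a = 1)
    (hσ : ∀ h a H, σ (O.predict h a (adv H).1) (adv H).2 ∈ stdSimplex ℝ (Assortment N K))
    {Φ : List (Observation X N K) → ℝ} (hΦ : ∀ h, 0 ≤ Φ h) {c : ℝ}
    (hstep : ∀ h H, ∑ a, O.prob h a * ∑ S, σ (O.predict h a (adv H).1) (adv H).2 S *
      ∑ i, mnl S.1 (fstar (adv H).1) i *
        (optReward K (fstar (adv H).1) (adv H).2 - expReward S.1 (fstar (adv H).1) (adv H).2 +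
          Φ (⟨(adv H).1, S, i⟩ :: h)) ≤ c + Φ h) (T : ℕ) :
    regret O σ fstar adv T ≤ T * c + Φ [] := by
  -- The induction runs over the remaining rounds from an arbitrary record, with the regret
  -- accumulated so far kept on the right. At the end the potential is dropped by nonnegativity.
  have main : ∀ (n : ℕ) (H : List (Round X N K)),
      expectation O σ fstar adv (fun h => (h.map fun ρ =>
        optReward K (fstar ρ.x) ρ.r - expReward ρ.S.1 (fstar ρ.x) ρ.r).sum) n H ≤
      (H.map fun ρ => optReward K (fstar ρ.x) ρ.r - expReward ρ.S.1 (fstar ρ.x) ρ.r).sum +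
        n * c + Φ (H.map Round.toObservation) := by
    intro n
    induction n with
    | zero =>
      intro H
      simpa [expectation] using hΦ _
    | succ n ih =>
      intro H
      have hs := hstep (H.map Round.toObservation) H
      simp only [expectation]
      refine (sum_round_mono (hO _) (fun a S => (hσ _ a H).1 S) (hf _)
        fun a S i => ih _).trans ?_
      simp only [List.map_cons, List.sum_cons]
      have e : ∀ a b d e f : ℝ, a - b + d + e + f = (d + e) + (a - b + f) := fun _ _ _ _ _ =>
        by ring
      simp only [e]
      rw [sum_round_add, sum_round_const (hO1 _) (fun a => (hσ _ a H).2) (hf _)]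
      push_cast
      linarith
  simpa [regret] using main T []

/-- The expected regret of the log-barrier strategy with an oracle that has small excess log loss
in the sense of a potential `Ψ`. -/
theorem regret_le_of_potential (hK : 1 ≤ K) (hKN : K ≤ N) {γ : ℝ} (hγ : 0 < γ)
    {O : OnlineOracle ι X N K} {σ : (Fin N → ℝ) → (Fin N → ℝ) → Assortment N K → ℝ}
    (hσ : IsLogBarrierStrategy γ σ) {fstar : X → Fin N → ℝ}
    {adv : Adversary X N K} (hadv : ∀ h i, (adv h).2 i ∈ Set.Icc (0 : ℝ) 1)
    (hf : ∀ x i, 0 ≤ fstar x i) (hf1 : ∀ x i, fstar x i ≤ 1)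
    (hO : ∀ h a, 0 ≤ O.prob h a) (hO1 : ∀ h, ∑ a, O.prob h a = 1)
    (hv : ∀ h a x i, O.predict h a x i ∈ Set.Icc (0 : ℝ) 1)
    {π : List (Observation X N K) → κ → ℝ} (hπ : ∀ h k, 0 ≤ π h k)
    {y : List (Observation X N K) → κ → X → Fin N → ℝ} (hy : ∀ h k x i, 0 < y h k x i)
    (hy1 : ∀ h k x i, y h k x i ≤ 1)
    (hvy : ∀ h x i, ∑ a, O.prob h a * (O.predict h a x i - fstar x i) ^ 2 ≤
      ∑ k, π h k * (y h k x i - fstar x i) ^ 2)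
    {Ψ : List (Observation X N K) → ℝ} (hΨ : ∀ h, 0 ≤ Ψ h) {e : ℝ}
    (hstep : ∀ h o, Ψ (o :: h) ≤ Ψ h + e - ∑ k, π h k *
      (logLoss (mnl o.S.1 (y h k o.x)) o.i - logLoss (mnl o.S.1 (fstar o.x)) o.i)) (T : ℕ) :
    regret O σ fstar adv T ≤
      2 * ((K : ℝ) + 1) ^ 4 * N * T / γ + 4 * (T * e + Ψ []) * γ := by
  have hmax : ∀ h a H, IsLogBarrierMaximizer γ (O.predict h a (adv H).1) (adv H).2
      (σ (O.predict h a (adv H).1) (adv H).2) :=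
    fun h a H => hσ _ _ (hv h a _) (hadv H)
  -- The scaling `4 * γ` is the coefficient of the excess log loss in
  -- `sum_optReward_sub_le_logLoss`, so the decrease of the potential cancels that term.
  refine (regret_le_of_step hf hO hO1 (fun h a H => (hmax h a H).1) (Φ := fun h => 4 * γ * Ψ h)
    (fun h => mul_nonneg (by positivity) (hΨ h))
    (c := 2 * (((K : ℝ) + 1) ^ 4 / γ) * N + 4 * γ * e) ?_ T).trans_eq ?_
  · intro h H
    have h1 := sum_optReward_sub_le_logLoss hK hKN hγ (hO h) (hO1 h)
      (fun a i => (hv h a (adv H).1 i).1) (hf _) (hf1 _) (hadv H) (fun a => hmax h a H)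
      (hπ h) (fun k i => hy h k (adv H).1 i) (fun k i => hy1 h k _ i) (fun i => hvy h _ i)
    set p := O.prob h
    set q := fun a => σ (O.predict h a (adv H).1) (adv H).2 with hq
    set u := fstar (adv H).1
    set L : Assortment N K → Option (Fin N) → ℝ := fun S i =>
      ∑ k, π h k * (logLoss (mnl S.1 (y h k (adv H).1)) i - logLoss (mnl S.1 u) i) with hL
    have h2 : ∑ a, p a * ∑ S, q a S * ∑ i, mnl S.1 u i *
        (optReward K u (adv H).2 - expReward S.1 u (adv H).2) =
        ∑ a, p a * ∑ S, q a S * (optReward K u (adv H).2 - expReward S.1 u (adv H).2) := by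
      simp only [← Finset.sum_mul, sum_mnl (hf _), one_mul, u]
    have h3 := sum_round_mono (hO h) (fun a S => (hmax h a H).1.1 S) (hf (adv H).1)
      (g₁ := fun _ S i => 4 * γ * Ψ (⟨(adv H).1, S, i⟩ :: h))
      (g₂ := fun _ S i => 4 * γ * (Ψ h + e) + -(4 * γ) * L S i)
      (fun a S i => by
        have := mul_le_mul_of_nonneg_left (hstep h ⟨(adv H).1, S, i⟩) (by positivity : 0 ≤ 4 * γ)
        simp only [hL]
        linarith)
    rw [sum_round_add, sum_round_const (hO1 h) (fun a => (hmax h a H).1.2) (hf _)] at h3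
    have h4 : ∑ a, p a * ∑ S, q a S * ∑ i, mnl S.1 u i * (-(4 * γ) * L S i) =
        -(4 * γ) * ∑ a, p a * ∑ S, q a S * ∑ i, mnl S.1 u i * L S i := by
      simp only [mul_left_comm _ (-(4 * γ)), ← Finset.mul_sum]
    rw [sum_round_add]
    simp only [hq] at h1 h2 h4
    linarith
  · field_simp
    ring

end Potential

/-! ### Excess log loss and regret of Hedge -/

section HedgeRegret

/-- Hoeffding's lemma for a finitely supported distribution. -/
theorem log_sum_mul_exp_le {κ : Type*} [Fintype κ] {p y : κ → ℝ} (hp : ∀ k, 0 ≤ p k)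
    (hp1 : ∑ k, p k = 1) {d : ℝ} (hd : ∀ k l, y k - y l ≤ d) :
    Real.log (∑ k, p k * Real.exp (y k)) ≤ ∑ k, p k * y k + d ^ 2 / 2 := by
  obtain ⟨k₀, hk₀⟩ : ∃ k, p k ≠ 0 := by
    by_contra! h
    simp [h] at hp1
  have hd0 : 0 ≤ d := by simpa using hd k₀ k₀
  set m := ∑ k, p k * y k with hm
  have hym : ∀ k, |y k - m| ≤ d := by
    intro k
    have h1 : y k - m = ∑ l, p l * (y k - y l) := by
      simp only [mul_sub, Finset.sum_sub_distrib, ← Finset.sum_mul, hp1, one_mul, hm]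
    rw [h1]
    refine (Finset.abs_sum_le_sum_abs _ _).trans ?_
    calc ∑ l, |p l * (y k - y l)| ≤ ∑ l, p l * d := Finset.sum_le_sum fun l _ => by
          rw [abs_mul, abs_of_nonneg (hp l)]
          exact mul_le_mul_of_nonneg_left
            (abs_le.2 ⟨by linarith [hd l k], hd k l⟩) (hp l)
      _ = d := by rw [← Finset.sum_mul, hp1, one_mul]
  -- On `[-d, d]` the exponential lies below its chord, and the linear part of the chord has mean
  -- zero. For `d = 0` the quotient is 0 by convention and every `y k` equals the mean. The full
  -- range `d` serves as the radius, hence `d ^ 2 / 2` and not the sharp `d ^ 2 / 8`.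
  have hexp : ∀ k, Real.exp (y k) ≤
      Real.exp m * (Real.cosh d + (y k - m) / d * Real.sinh d) := by
    intro k
    have ht : |(y k - m) / d| ≤ 1 := by
      rw [abs_div, abs_of_nonneg hd0]
      exact div_le_one_of_le₀ (hym k) hd0
    have htd : (y k - m) / d * d = y k - m := by
      rcases hd0.eq_or_lt with h | h
      · have := abs_nonpos_iff.1 ((hym k).trans_eq h.symm)
        simp [this]
      · field_simp
    have h1 := Real.exp_mul_le_cosh_add_mul_sinh ht d
    rw [htd] at h1
    calc Real.exp (y k) = Real.exp m * Real.exp (y k - m) := by rw [← Real.exp_add]; ring_nf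
      _ ≤ _ := mul_le_mul_of_nonneg_left h1 (Real.exp_pos _).le
  have hsum : ∑ k, p k * Real.exp (y k) ≤ Real.exp (m + d ^ 2 / 2) := by
    calc ∑ k, p k * Real.exp (y k)
        ≤ ∑ k, p k * (Real.exp m * (Real.cosh d + (y k - m) / d * Real.sinh d)) :=
          Finset.sum_le_sum fun k _ => mul_le_mul_of_nonneg_left (hexp k) (hp k)
      _ = ∑ k, (p k * (Real.exp m * Real.cosh d - Real.exp m * m / d * Real.sinh d) +
            p k * y k * (Real.exp m / d * Real.sinh d)) :=
          Finset.sum_congr rfl fun k _ => by ring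
      _ = Real.exp m * Real.cosh d := by
          rw [Finset.sum_add_distrib, ← Finset.sum_mul, ← Finset.sum_mul, hp1, ← hm]
          ring
      _ ≤ Real.exp m * Real.exp (d ^ 2 / 2) :=
          mul_le_mul_of_nonneg_left (Real.cosh_le_exp_half_sq d) (Real.exp_pos _).le
      _ = _ := (Real.exp_add _ _).symm
  have hpos : 0 < ∑ k, p k * Real.exp (y k) :=
    Finset.sum_pos' (fun k _ => mul_nonneg (hp k) (Real.exp_pos _).le)
      ⟨k₀, Finset.mem_univ _, mul_pos ((hp k₀).lt_of_ne' hk₀) (Real.exp_pos _)⟩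
  exact (Real.log_le_iff_le_exp hpos).2 hsum

theorem logLoss_sub_le {N : ℕ} {β : ℝ} (hβ : 0 < β) (hβ1 : β ≤ 1) {v u : Fin N → ℝ}
    (hv : ∀ i, v i ∈ Set.Icc β 1) (hu : ∀ i, u i ∈ Set.Icc β 1) (S : Finset (Fin N))
    (i : Option (Fin N)) :
    logLoss (mnl S v) i - logLoss (mnl S u) i ≤ 2 * Real.log (1 / β) := by
  have hv0 : ∀ i, 0 < v i := fun i => hβ.trans_le (hv i).1
  have hu0 : ∀ i, 0 < u i := fun i => hβ.trans_le (hu i).1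
  have hZ := one_add_sum_pos (fun i => (hv0 i).le) S
  have hY := one_add_sum_pos (fun i => (hu0 i).le) S
  have hlog : 0 ≤ Real.log (1 / β) := Real.log_nonneg ((one_le_div hβ).2 hβ1)
  have hlogβ : Real.log (1 / β) = -Real.log β := by rw [one_div, Real.log_inv]
  -- The normalizers differ by a factor of at most `1 / β`, independently of the size of `S`; the
  -- numerators cost a second such factor.
  have h1 : Real.log (1 + ∑ j ∈ S, v j) + Real.log β ≤ Real.log (1 + ∑ j ∈ S, u j) := by
    rw [← Real.log_mul hZ.ne' hβ.ne']
    refine Real.log_le_log (mul_pos hZ hβ) ?_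
    rw [add_mul, Finset.sum_mul, one_mul]
    refine add_le_add hβ1 (Finset.sum_le_sum fun j _ => ?_)
    nlinarith [(hv j).2, (hu j).1]
  cases i with
  | none =>
    simp only [logLoss, mnl, one_div, Real.log_inv] at hlogβ hlog ⊢
    linarith
  | some i =>
    simp only [logLoss, mnl]
    split_ifs
    · rw [Real.log_div (hv0 i).ne' hZ.ne', Real.log_div (hu0 i).ne' hY.ne']
      have h2 : Real.log β ≤ Real.log (v i) := Real.log_le_log hβ (hv i).1
      have h3 : Real.log (u i) ≤ 0 := Real.log_nonpos (hu0 i).le (hu i).2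
      linarith
    -- An outcome outside `S` has probability 0 under both models, and both losses are 0 since
    -- `Real.log 0 = 0`. Such impossible observations are included because the potential step is
    -- required for all of them.
    · rw [sub_self]
      positivity

variable {X : Type*} {N K : ℕ}

theorem sum_exp_cumLoss_pos (η : ℝ) {F : Finset (X → Fin N → ℝ)} (hF : F.Nonempty)
    (h : List (Observation X N K)) : 0 < ∑ g ∈ F, Real.exp (-η * cumLoss g h) :=
  Finset.sum_pos (fun _ _ => Real.exp_pos _) hF

theorem hedgeWeight_nonneg (η : ℝ) (F : Finset (X → Fin N → ℝ)) (h : List (Observation X N K))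
    (f : X → Fin N → ℝ) : 0 ≤ hedgeWeight η F h f :=
  div_nonneg (Real.exp_pos _).le (Finset.sum_nonneg fun _ _ => (Real.exp_pos _).le)

theorem sum_hedgeWeight (η : ℝ) {F : Finset (X → Fin N → ℝ)} (hF : F.Nonempty)
    (h : List (Observation X N K)) : ∑ f : F, hedgeWeight η F h f.1 = 1 := by
  rw [Finset.sum_coe_sort F (hedgeWeight η F h)]
  simp only [hedgeWeight, ← Finset.sum_div]
  exact div_self (sum_exp_cumLoss_pos η hF h).ne'

/-- The potential of Hedge relative to the predictor `u`. -/
noncomputable def hedgePotential (η : ℝ) (F : Finset (X → Fin N → ℝ)) (u : X → Fin N → ℝ)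
    (h : List (Observation X N K)) : ℝ :=
  Real.log (∑ g ∈ F, Real.exp (-η * cumLoss g h)) / η + cumLoss u h

/-- The normalizer contains the summand of `u` itself. -/
theorem hedgePotential_nonneg {η : ℝ} (hη : 0 < η) {F : Finset (X → Fin N → ℝ)}
    {u : X → Fin N → ℝ} (hu : u ∈ F) (h : List (Observation X N K)) :
    0 ≤ hedgePotential η F u h := by
  have h1 : Real.exp (-η * cumLoss u h) ≤ ∑ g ∈ F, Real.exp (-η * cumLoss g h) :=
    Finset.single_le_sum (f := fun g => Real.exp (-η * cumLoss g h))
      (fun _ _ => (Real.exp_pos _).le) hu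
  have h2 := (Real.le_log_iff_exp_le (sum_exp_cumLoss_pos η ⟨u, hu⟩ h)).2 h1
  have h3 : -cumLoss u h ≤ Real.log (∑ g ∈ F, Real.exp (-η * cumLoss g h)) / η := by
    rw [le_div_iff₀ hη]
    linarith
  unfold hedgePotential
  linarith

/-- The ratio of successive normalizers is the exponential moment of `-η` times the loss under the
current weights, so Hoeffding's lemma with range `η * D` bounds its logarithm. -/
theorem hedgePotential_cons_le {η : ℝ} (hη : 0 < η) {F : Finset (X → Fin N → ℝ)}
    {u : X → Fin N → ℝ} (hu : u ∈ F) {D : ℝ}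
    (hD : ∀ f ∈ F, ∀ g ∈ F, ∀ (x : X) (S : Assortment N K) (i : Option (Fin N)),
      logLoss (mnl S.1 (f x)) i - logLoss (mnl S.1 (g x)) i ≤ D)
    (h : List (Observation X N K)) (o : Observation X N K) :
    hedgePotential η F u (o :: h) ≤ hedgePotential η F u h + η * D ^ 2 / 2 -
      ∑ f : F, hedgeWeight η F h f.1 *
        (logLoss (mnl o.S.1 (f.1 o.x)) o.i - logLoss (mnl o.S.1 (u o.x)) o.i) := by
  have hF : F.Nonempty := ⟨u, hu⟩
  have hW := sum_exp_cumLoss_pos η hF h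
  have hW' := sum_exp_cumLoss_pos η hF (o :: h)
  have hp1 := sum_hedgeWeight η hF h
  have hcum : ∀ g : X → Fin N → ℝ,
      cumLoss g (o :: h) = logLoss (mnl o.S.1 (g o.x)) o.i + cumLoss g h := by
    intro g
    simp [cumLoss]
  have hratio : ∑ f : F, hedgeWeight η F h f.1 *
      Real.exp (-η * logLoss (mnl o.S.1 (f.1 o.x)) o.i) =
      (∑ g ∈ F, Real.exp (-η * cumLoss g (o :: h))) / ∑ g ∈ F, Real.exp (-η * cumLoss g h) := by
    rw [Finset.sum_coe_sort F fun f => hedgeWeight η F h f *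
      Real.exp (-η * logLoss (mnl o.S.1 (f o.x)) o.i), Finset.sum_div]
    refine Finset.sum_congr rfl fun f _ => ?_
    rw [hedgeWeight, hcum, mul_add, Real.exp_add]
    ring
  have hlog := log_sum_mul_exp_le (fun f : F => hedgeWeight_nonneg η F h f.1) hp1
    (y := fun f => -η * logLoss (mnl o.S.1 (f.1 o.x)) o.i) (d := η * D)
    (fun f g => by
      have := mul_le_mul_of_nonneg_left (hD g.1 g.2 f.1 f.2 o.x o.S o.i) hη.le
      linarith)
  rw [hratio, Real.log_div hW'.ne' hW.ne'] at hlog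
  have hmean : ∑ f : F, hedgeWeight η F h f.1 * (-η * logLoss (mnl o.S.1 (f.1 o.x)) o.i) =
      -η * ∑ f : F, hedgeWeight η F h f.1 * logLoss (mnl o.S.1 (f.1 o.x)) o.i := by
    rw [Finset.mul_sum]
    exact Finset.sum_congr rfl fun f _ => by ring
  rw [hmean] at hlog
  simp only [mul_sub, Finset.sum_sub_distrib, ← Finset.sum_mul, hp1, one_mul]
  unfold hedgePotential
  rw [hcum u]
  have h1 : Real.log (∑ g ∈ F, Real.exp (-η * cumLoss g (o :: h))) / η ≤
      Real.log (∑ g ∈ F, Real.exp (-η * cumLoss g h)) / η + η * D ^ 2 / 2 -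
        ∑ f : F, hedgeWeight η F h f.1 * logLoss (mnl o.S.1 (f.1 o.x)) o.i := by
    rw [div_le_iff₀ hη, sub_mul, add_mul, div_mul_cancel₀ _ hη.ne']
    linarith
  linarith

theorem sq_sum_mul_sub_le {κ : Type*} [Fintype κ] {p : κ → ℝ} (hp : ∀ k, 0 ≤ p k)
    (hp1 : ∑ k, p k = 1) (y : κ → ℝ) (u : ℝ) :
    (∑ k, p k * y k - u) ^ 2 ≤ ∑ k, p k * (y k - u) ^ 2 := by
  have h := Real.pow_arith_mean_le_arith_mean_pow_of_even Finset.univ p (fun k => y k - u)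
    (fun k _ => hp k) hp1 even_two
  simpa only [mul_sub, Finset.sum_sub_distrib, ← Finset.sum_mul, hp1, one_mul] using h

theorem regret_hedge_le (hK : 1 ≤ K) (hKN : K ≤ N) {γ : ℝ} (hγ : 0 < γ)
    {σ : (Fin N → ℝ) → (Fin N → ℝ) → Assortment N K → ℝ} (hσ : IsLogBarrierStrategy γ σ)
    {adv : Adversary X N K} (hadv : ∀ h i, (adv h).2 i ∈ Set.Icc (0 : ℝ) 1)
    {β : ℝ} (hβ : 0 < β) (hβ1 : β ≤ 1) {F : Finset (X → Fin N → ℝ)}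
    (hF : ∀ f ∈ F, ∀ x i, f x i ∈ Set.Icc β 1) {u : X → Fin N → ℝ} (hu : u ∈ F)
    {η : ℝ} (hη : 0 < η) (T : ℕ) :
    regret (hedgeSample η F) σ u adv T ≤ 2 * ((K : ℝ) + 1) ^ 4 * N * T / γ +
        4 * (T * (η * (2 * Real.log (1 / β)) ^ 2 / 2) + Real.log F.card / η) * γ ∧
      regret (hedgeMean η F) σ u adv T ≤ 2 * ((K : ℝ) + 1) ^ 4 * N * T / γ +
        4 * (T * (η * (2 * Real.log (1 / β)) ^ 2 / 2) + Real.log F.card / η) * γ := by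
  have hne : F.Nonempty := ⟨u, hu⟩
  have hu0 : ∀ x i, 0 ≤ u x i := fun x i => hβ.le.trans (hF u hu x i).1
  have hu1 : ∀ x i, u x i ≤ 1 := fun x i => (hF u hu x i).2
  have hΨ : hedgePotential (K := K) η F u [] = Real.log F.card / η := by
    simp [hedgePotential, cumLoss]
  have hy : ∀ (h : List (Observation X N K)) (k : F) (x : X) (i : Fin N), 0 < k.1 x i :=
    fun _ k x i => hβ.trans_le (hF k.1 k.2 x i).1
  have hy1 : ∀ (h : List (Observation X N K)) (k : F) (x : X) (i : Fin N), k.1 x i ≤ 1 :=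
    fun _ k x i => (hF k.1 k.2 x i).2
  have hw0 := fun (h : List (Observation X N K)) (k : F) => hedgeWeight_nonneg η F h k.1
  have hw1 := fun h : List (Observation X N K) => sum_hedgeWeight η hne h
  have hstep := hedgePotential_cons_le (K := K) hη hu (D := 2 * Real.log (1 / β))
    fun f hf g hg x S i => logLoss_sub_le hβ hβ1 (hF f hf x) (hF g hg x) S.1 i
  have hmean : ∀ (h : List (Observation X N K)) (a : Unit) (x : X) (i : Fin N),
      (hedgeMean η F).predict h a x i = ∑ f : F, hedgeWeight η F h f.1 * f.1 x i := by
    intro h a x i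
    rw [Finset.sum_coe_sort F fun f => hedgeWeight η F h f * f x i]
    simp [hedgeMean, Finset.sum_apply]
  rw [← hΨ]
  constructor
  · exact regret_le_of_potential hK hKN hγ hσ hadv hu0 hu1 hw0 hw1
      (fun h a x i => ⟨(hy h a x i).le, hy1 h a x i⟩) hw0 hy hy1 (fun _ _ _ => le_rfl)
      (hedgePotential_nonneg hη hu) hstep T
  -- The averaged predictor is deterministic, but the comparison family is still `F` with the Hedge
  -- weights; convexity of the square (`sq_sum_mul_sub_le`) links the two.
  · refine regret_le_of_potential hK hKN hγ hσ hadv hu0 hu1 (fun _ _ => zero_le_one)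
      (fun _ => by simp [hedgeMean]) (fun h a x i => ?_) hw0 hy hy1 (fun h x i => ?_)
      (hedgePotential_nonneg hη hu) hstep T
    · rw [hmean]
      refine ⟨Finset.sum_nonneg fun k _ => mul_nonneg (hw0 h k) (hy h k x i).le, ?_⟩
      rw [← hw1 h]
      exact Finset.sum_le_sum fun k _ => mul_le_of_le_one_right (hw0 h k) (hy1 h k x i)
    · simp only [hmean]
      simpa [hedgeMean] using sq_sum_mul_sub_le (hw0 h) (hw1 h) (fun k : F => k.1 x i) (u x i)

end HedgeRegret

/-! ### Excess log loss and regret of online gradient descent -/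

section GradientDescent

variable {d N K : ℕ}

theorem norm_projBall_le {B : ℝ} (hB : 0 ≤ B) (θ : EuclideanSpace ℝ (Fin d)) :
    ‖projBall B θ‖ ≤ B := by
  unfold projBall
  split_ifs with h
  · exact h
  · rw [norm_smul, Real.norm_eq_abs, abs_of_nonneg (by positivity)]
    exact (div_mul_cancel₀ B (hB.trans_lt (not_le.1 h)).ne').le

theorem norm_projBall_sub_sq_le {B : ℝ} (hB : 0 ≤ B) (θ : EuclideanSpace ℝ (Fin d))
    {u : EuclideanSpace ℝ (Fin d)} (hu : ‖u‖ ≤ B) :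
    ‖projBall B θ - u‖ ^ 2 ≤ ‖θ - u‖ ^ 2 := by
  unfold projBall
  split_ifs with h
  · exact le_rfl
  · have hlt : B < ‖θ‖ := not_le.1 h
    have hθ : 0 < ‖θ‖ := hB.trans_lt hlt
    have hin : inner ℝ θ u ≤ ‖θ‖ * B :=
      (real_inner_le_norm θ u).trans (mul_le_mul_of_nonneg_left hu hθ.le)
    rw [norm_sub_sq_real, norm_sub_sq_real, real_inner_smul_left, norm_smul, Real.norm_eq_abs,
      abs_of_nonneg (by positivity), div_mul_cancel₀ B hθ.ne']
    have h1 : 0 ≤ 1 - B / ‖θ‖ := sub_nonneg.2 ((div_le_one hθ).2 hlt.le)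
    have h2 := mul_le_mul_of_nonneg_left hin h1
    have h3 : (1 - B / ‖θ‖) * (‖θ‖ * B) = (‖θ‖ - B) * B := by field_simp
    -- The squared distance drops by at least `(‖θ‖ - B) ^ 2`.
    nlinarith [sq_nonneg (‖θ‖ - B)]

theorem linearValue_pos (B : ℝ) (θ : EuclideanSpace ℝ (Fin d))
    (x : Fin N → EuclideanSpace ℝ (Fin d)) (i : Fin N) : 0 < linearValue B θ x i :=
  Real.exp_pos _

theorem hasGradientAt_inner_left (a θ : EuclideanSpace ℝ (Fin d)) :
    HasGradientAt (fun θ : EuclideanSpace ℝ (Fin d) => inner ℝ θ a) a θ := by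
  rw [hasGradientAt_iff_hasFDerivAt]
  have h : (fun θ : EuclideanSpace ℝ (Fin d) => inner ℝ θ a) =
    InnerProductSpace.toDual ℝ (EuclideanSpace ℝ (Fin d)) a := by
    funext w
    rw [InnerProductSpace.toDual_apply_apply, real_inner_comm]
  rw [h]
  exact ContinuousLinearMap.hasFDerivAt _

theorem hasGradientAt_log_one_add_sum_exp (B : ℝ) (S : Finset (Fin N))
    (x : Fin N → EuclideanSpace ℝ (Fin d)) (θ : EuclideanSpace ℝ (Fin d)) :
    HasGradientAt (fun θ => Real.log (1 + ∑ j ∈ S, linearValue B θ x j))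
      (∑ j ∈ S, mnl S (linearValue B θ x) (some j) • x j) θ := by
  have hZ := one_add_sum_pos (v := linearValue B θ x) (fun i => (Real.exp_pos _).le) S
  have hexp : ∀ j, HasFDerivAt (fun θ : EuclideanSpace ℝ (Fin d) => linearValue B θ x j)
      (linearValue B θ x j • InnerProductSpace.toDual ℝ (EuclideanSpace ℝ (Fin d))
        (x j)) θ := fun j =>
    ((hasGradientAt_iff_hasFDerivAt.1 (hasGradientAt_inner_left (x j) θ)).sub_const B).exp
  have h := ((HasFDerivAt.fun_sum fun j (_ : j ∈ S) => hexp j).const_add 1).log hZ.ne'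
  rw [hasGradientAt_iff_hasFDerivAt]
  refine h.congr_fderiv ?_
  simp only [map_sum, map_smulₛₗ, Finset.smul_sum, smul_smul]
  refine Finset.sum_congr rfl fun j hj => ?_
  simp [mnl, hj, div_eq_inv_mul]

theorem norm_sum_mnl_smul_le {B : ℝ} {x : Fin N → EuclideanSpace ℝ (Fin d)} (hx : ∀ i, ‖x i‖ ≤ 1)
    (S : Finset (Fin N)) (θ : EuclideanSpace ℝ (Fin d)) :
    ‖∑ j ∈ S, mnl S (linearValue B θ x) (some j) • x j‖ ≤ 1 := by
  have hv : ∀ i, 0 ≤ linearValue B θ x i := fun i => (Real.exp_pos _).le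
  calc ‖∑ j ∈ S, mnl S (linearValue B θ x) (some j) • x j‖
      ≤ ∑ j ∈ S, mnl S (linearValue B θ x) (some j) * 1 := by
        refine norm_sum_le_of_le _ fun j _ => ?_
        rw [norm_smul, Real.norm_eq_abs, abs_of_nonneg (mnl_nonneg hv S _)]
        exact mul_le_mul_of_nonneg_left (hx j) (mnl_nonneg hv S _)
    -- With unit rewards, the total purchase probability is an expected reward.
    _ = expReward S (linearValue B θ x) fun _ => 1 := rfl
    _ ≤ 1 := (expReward_mem_Icc hv (fun _ => by simp) S).2

/-- The gradient inequality for log-sum-exp, proved by Jensen: `exp s ≥ 1 + s` is applied to each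
exponent increment minus its mean `m`, where the outside option has increment 0. -/
theorem log_one_add_sum_exp_convex (B : ℝ) (S : Finset (Fin N))
    (x : Fin N → EuclideanSpace ℝ (Fin d)) (θ u : EuclideanSpace ℝ (Fin d)) :
    Real.log (1 + ∑ j ∈ S, linearValue B θ x j) +
        inner ℝ (∑ j ∈ S, mnl S (linearValue B θ x) (some j) • x j) (u - θ) ≤
      Real.log (1 + ∑ j ∈ S, linearValue B u x j) := by
  have hv : ∀ i, 0 ≤ linearValue B θ x i := fun i => (Real.exp_pos _).le
  have hZ := one_add_sum_pos hv S
  have hY := one_add_sum_pos (v := linearValue B u x) (fun i => (Real.exp_pos _).le) S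
  set Z := 1 + ∑ j ∈ S, linearValue B θ x j with hZd
  set Y := 1 + ∑ j ∈ S, linearValue B u x j with hYd
  set g := ∑ j ∈ S, mnl S (linearValue B θ x) (some j) • x j with hg
  set m := inner ℝ g (u - θ) with hm
  have hmS : Z * m = ∑ j ∈ S, linearValue B θ x j * inner ℝ (x j) (u - θ) := by
    rw [hm, hg, sum_inner, Finset.mul_sum]
    refine Finset.sum_congr rfl fun j hj => ?_
    rw [real_inner_smul_left]
    simp only [mnl, hj, if_true, ← hZd]
    field_simp
  have hterm : ∀ j, linearValue B θ x j * (1 + inner ℝ (x j) (u - θ) - m) ≤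
      linearValue B u x j * Real.exp (-m) := by
    intro j
    have h1 : linearValue B u x j * Real.exp (-m) =
        linearValue B θ x j * Real.exp (inner ℝ (x j) (u - θ) - m) := by
      simp only [linearValue, ← Real.exp_add]
      rw [inner_sub_right, real_inner_comm, real_inner_comm θ]
      ring_nf
    rw [h1]
    refine mul_le_mul_of_nonneg_left ?_ (hv j)
    linarith [Real.add_one_le_exp (inner ℝ (x j) (u - θ) - m)]
  have hsum : Z ≤ Y * Real.exp (-m) := by
    have h1 := Finset.sum_le_sum fun j (_ : j ∈ S) => hterm j
    have h2 : ∑ j ∈ S, linearValue B θ x j * (1 + inner ℝ (x j) (u - θ) - m) =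
        (Z - 1) + Z * m - (Z - 1) * m := by
      rw [hmS, hZd, add_sub_cancel_left, Finset.sum_mul, ← Finset.sum_add_distrib,
        ← Finset.sum_sub_distrib]
      exact Finset.sum_congr rfl fun j _ => by ring
    rw [h2, ← Finset.sum_mul] at h1
    have h3 := Real.add_one_le_exp (-m)
    rw [hYd, add_mul, one_mul]
    linarith
  have h1 := Real.log_le_log hZ hsum
  rw [Real.log_mul hY.ne' (Real.exp_pos _).ne', Real.log_exp] at h1
  linarith

/-- The log loss is convex in the parameter of the linear class, with gradients of norm at most
`2`. -/
theorem logLoss_linearValue_gradient (B : ℝ) {x : Fin N → EuclideanSpace ℝ (Fin d)}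
    (hx : ∀ i, ‖x i‖ ≤ 1)
    (S : Finset (Fin N)) (i : Option (Fin N)) (θ u : EuclideanSpace ℝ (Fin d)) :
    ‖gradient (fun θ => logLoss (mnl S (linearValue B θ x)) i) θ‖ ≤ 2 ∧
      logLoss (mnl S (linearValue B θ x)) i - logLoss (mnl S (linearValue B u x)) i ≤
        inner ℝ (gradient (fun θ => logLoss (mnl S (linearValue B θ x)) i) θ) (θ - u) := by
  have hgrad := hasGradientAt_log_one_add_sum_exp B S x θ
  have hnorm := norm_sum_mnl_smul_le (B := B) hx S θ
  have hconv := log_one_add_sum_exp_convex B S x θ u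
  rw [← neg_sub θ u, inner_neg_right] at hconv
  have hZ : ∀ θ : EuclideanSpace ℝ (Fin d), 1 + ∑ j ∈ S, linearValue B θ x j ≠ 0 := fun θ =>
    (one_add_sum_pos (v := linearValue B θ x) (fun i => (Real.exp_pos _).le) S).ne'
  set g := ∑ j ∈ S, mnl S (linearValue B θ x) (some j) • x j
  cases i with
  | none =>
    simp only [logLoss, mnl, one_div, Real.log_inv, neg_neg, hgrad.gradient]
    exact ⟨by linarith, by linarith⟩
  | some j =>
    by_cases hj : j ∈ S
    · have hL : ∀ θ : EuclideanSpace ℝ (Fin d), logLoss (mnl S (linearValue B θ x)) (some j) =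
          Real.log (1 + ∑ j ∈ S, linearValue B θ x j) - (inner ℝ θ (x j) - B) := by
        intro θ
        simp only [logLoss, mnl, hj, if_true]
        have hj0 : Real.log (linearValue B θ x j) = inner ℝ θ (x j) - B := Real.log_exp _
        rw [Real.log_div (linearValue_pos B θ x j).ne' (hZ θ), hj0]
        ring
      have hlin : HasGradientAt (fun θ : EuclideanSpace ℝ (Fin d) => inner ℝ θ (x j) - B)
        (x j) θ := by
        have h1 := hasGradientAt_inner_left (x j) θ
        rw [hasGradientAt_iff_hasFDerivAt] at h1 ⊢
        exact h1.sub_const B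
      have hsub : HasGradientAt (fun θ : EuclideanSpace ℝ (Fin d) =>
        Real.log (1 + ∑ j ∈ S, linearValue B θ x j) -
          (inner ℝ θ (x j) - B)) (g - x j) θ := by
        rw [hasGradientAt_iff_hasFDerivAt] at hgrad hlin ⊢
        rw [map_sub]
        exact hgrad.sub hlin
      simp only [hL, hsub.gradient]
      refine ⟨(norm_sub_le _ _).trans (by linarith [hx j]), ?_⟩
      rw [inner_sub_left, inner_sub_right (x j), real_inner_comm θ, real_inner_comm u]
      linarith
    · simp [logLoss, mnl, hj]

theorem norm_ogdIterate_le {η B : ℝ} (hB : 0 ≤ B) {θ₁ : EuclideanSpace ℝ (Fin d)} (hθ₁ : ‖θ₁‖ ≤ B)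
    {X : Set (Fin N → EuclideanSpace ℝ (Fin d))} (h : List (Observation X N K)) :
    ‖ogdIterate η B θ₁ h‖ ≤ B := by
  cases h with
  | nil => exact hθ₁
  | cons o h => exact norm_projBall_le hB _

theorem linearValue_mem_Ioc {B : ℝ} {θ : EuclideanSpace ℝ (Fin d)} (hθ : ‖θ‖ ≤ B)
    {x : Fin N → EuclideanSpace ℝ (Fin d)}
    (hx : ∀ i, ‖x i‖ ≤ 1) (i : Fin N) : linearValue B θ x i ∈ Set.Ioc (0 : ℝ) 1 := by
  refine ⟨Real.exp_pos _, Real.exp_le_one_iff.2 (sub_nonpos.2 ?_)⟩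
  calc inner ℝ θ (x i) ≤ ‖θ‖ * ‖x i‖ := real_inner_le_norm _ _
    _ ≤ ‖θ‖ := mul_le_of_le_one_right (norm_nonneg _) (hx i)
    _ ≤ B := hθ

/-- Expanding the square after a gradient step produces the linearized regret, which dominates the
true one by convexity; projection only helps. The gradient bound 2 gives the error `η * 2 ^ 2 / 2`.
-/
theorem ogd_potential_cons_le {η B : ℝ} (hη : 0 < η) (hB : 0 ≤ B) (θ₁ : EuclideanSpace ℝ (Fin d))
    {X : Set (Fin N → EuclideanSpace ℝ (Fin d))} (hX : ∀ x ∈ X, ∀ i, ‖x i‖ ≤ 1)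
    {u : EuclideanSpace ℝ (Fin d)} (hu : ‖u‖ ≤ B)
    (h : List (Observation X N K)) (o : Observation X N K) :
    ‖ogdIterate η B θ₁ (o :: h) - u‖ ^ 2 / (2 * η) ≤
      ‖ogdIterate η B θ₁ h - u‖ ^ 2 / (2 * η) + 2 * η -
        (logLoss (mnl o.S.1 (linearValue B (ogdIterate η B θ₁ h) o.x.1)) o.i -
          logLoss (mnl o.S.1 (linearValue B u o.x.1)) o.i) := by
  obtain ⟨hn, hc⟩ := logLoss_linearValue_gradient B (hX o.x.1 o.x.2) o.S.1 o.i
    (ogdIterate η B θ₁ h) u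
  rw [ogdIterate]
  set θ := ogdIterate η B θ₁ h
  set g := gradient (fun θ => logLoss (mnl o.S.1 (linearValue B θ o.x.1)) o.i) θ
  have h1 := norm_projBall_sub_sq_le hB (θ - η • g) hu
  have h2 : ‖θ - η • g - u‖ ^ 2 = ‖θ - u‖ ^ 2 - 2 * η * inner ℝ g (θ - u) + η ^ 2 * ‖g‖ ^ 2 := by
    rw [sub_right_comm, norm_sub_sq_real, real_inner_smul_right, norm_smul, Real.norm_eq_abs,
      mul_pow, sq_abs, real_inner_comm]
    ring
  have h3 : ‖g‖ ^ 2 ≤ 4 := by nlinarith [norm_nonneg g]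
  have h4 := mul_le_mul_of_nonneg_left h3 (sq_nonneg η)
  have h5 := mul_le_mul_of_nonneg_left hc (by positivity : 0 ≤ 2 * η)
  rw [div_le_iff₀ (by positivity), sub_mul, add_mul, div_mul_cancel₀ _ (by positivity)]
  linarith

theorem regret_ogd_le (hK : 1 ≤ K) (hKN : K ≤ N) {γ : ℝ} (hγ : 0 < γ)
    {σ : (Fin N → ℝ) → (Fin N → ℝ) → Assortment N K → ℝ} (hσ : IsLogBarrierStrategy γ σ)
    {X : Set (Fin N → EuclideanSpace ℝ (Fin d))} (hX : ∀ x ∈ X, ∀ i, ‖x i‖ ≤ 1)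
    {adv : Adversary X N K} (hadv : ∀ h i, (adv h).2 i ∈ Set.Icc (0 : ℝ) 1)
    {η B : ℝ} (hη : 0 < η) (hB : 0 ≤ B) {θ₁ : EuclideanSpace ℝ (Fin d)} (hθ₁ : ‖θ₁‖ ≤ B)
    {fstar : X → Fin N → ℝ} (hf : fstar ∈ linearClass B X) (T : ℕ) :
    regret (ogd η B θ₁ X) σ fstar adv T ≤ 2 * ((K : ℝ) + 1) ^ 4 * N * T / γ +
      4 * (T * (2 * η) + 2 * B ^ 2 / η) * γ := by
  obtain ⟨u, hu, rfl⟩ := hf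
  have hv := fun (θ : EuclideanSpace ℝ (Fin d)) (hθ : ‖θ‖ ≤ B) (x : X) (i : Fin N) =>
    linearValue_mem_Ioc hθ (hX x.1 x.2) i
  have hit := fun h : List (Observation X N K) => norm_ogdIterate_le (η := η) hB hθ₁ h
  refine (regret_le_of_potential (κ := Unit) hK hKN hγ hσ hadv (fun x i => (hv u hu x i).1.le)
    (fun x i => (hv u hu x i).2) (fun _ _ => zero_le_one) (fun _ => by simp [ogd])
    (fun h _ x i => ⟨(hv _ (hit h) x i).1.le, (hv _ (hit h) x i).2⟩)
    (π := fun _ _ => 1) (fun _ _ => zero_le_one)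
    (y := fun h _ x => linearValue B (ogdIterate η B θ₁ h) x.1)
    (fun h _ x i => (hv _ (hit h) x i).1) (fun h _ x i => (hv _ (hit h) x i).2)
    (fun _ _ _ => le_rfl) (Ψ := fun h => ‖ogdIterate η B θ₁ h - u‖ ^ 2 / (2 * η))
    (fun h => by positivity) (e := 2 * η)
    (fun h o => by simpa using ogd_potential_cons_le hη hB θ₁ hX hu h o) T).trans ?_
  have h1 : ‖θ₁ - u‖ ≤ 2 * B := (norm_sub_le _ _).trans (by linarith)
  have h2 : ‖θ₁ - u‖ ^ 2 / (2 * η) ≤ 2 * B ^ 2 / η := by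
    rw [div_le_div_iff₀ (by positivity) hη]
    nlinarith [mul_le_mul_of_nonneg_right (pow_le_pow_left₀ (norm_nonneg _) h1 2) hη.le]
  simp only [ogdIterate]
  gcongr

end GradientDescent

/-! ### Choice of the exploration parameter -/

section Tuning

/-- The parameter `γ` of the log-barrier strategy for `T` rounds and excess log loss `E`. -/
noncomputable def tunedGamma (N K T : ℕ) (E : ℝ) : ℝ :=
  (K : ℝ) ^ 2 * √(N * T) / √E

theorem tunedGamma_pos {N K T : ℕ} (hK : 1 ≤ K) (hKN : K ≤ N) (hT : 1 ≤ T) {E : ℝ} (hE : 0 < E) :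
    0 < tunedGamma N K T E := by
  have hK0 : (0 : ℝ) < K := by exact_mod_cast hK
  have hN0 : (0 : ℝ) < N := by exact_mod_cast hK.trans hKN
  have hT0 : (0 : ℝ) < T := by exact_mod_cast hT
  unfold tunedGamma
  positivity

theorem tunedGamma_bound {N K T : ℕ} (hK : 1 ≤ K) (hKN : K ≤ N) (hT : 1 ≤ T) {E : ℝ}
    (hE : 0 < E) :
    2 * ((K : ℝ) + 1) ^ 4 * N * T / tunedGamma N K T E + 4 * E * tunedGamma N K T E ≤
      36 * ((K : ℝ) ^ 2 * √(N * T) * √E) := by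
  have hK1 : (1 : ℝ) ≤ K := by exact_mod_cast hK
  have hN0 : (0 : ℝ) < N := by exact_mod_cast hK.trans hKN
  have hT0 : (0 : ℝ) < T := by exact_mod_cast hT
  unfold tunedGamma
  have ha : 0 < √((N : ℝ) * T) := by positivity
  have hb : 0 < √E := by positivity
  have hNT : (N : ℝ) * T = √((N : ℝ) * T) ^ 2 := (Real.sq_sqrt (by positivity)).symm
  have hE2 : E = √E ^ 2 := (Real.sq_sqrt hE.le).symm
  generalize √((N : ℝ) * T) = a at *
  generalize √E = b at *
  -- This factor 16 accounts for 32 of the constant 36; the loss term contributes the other 4.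
  have hpow : ((K : ℝ) + 1) ^ 4 ≤ 16 * (K : ℝ) ^ 4 := by
    calc ((K : ℝ) + 1) ^ 4 ≤ (2 * K) ^ 4 := by gcongr; linarith
      _ = _ := by ring
  have h1 : 2 * ((K : ℝ) + 1) ^ 4 * N * T / ((K : ℝ) ^ 2 * a / b) ≤ 32 * ((K : ℝ) ^ 2 * a * b) := by
    rw [div_le_iff₀ (by positivity)]
    calc 2 * ((K : ℝ) + 1) ^ 4 * N * T = ((K : ℝ) + 1) ^ 4 * (2 * a ^ 2) := by rw [← hNT]; ring
      _ ≤ 16 * (K : ℝ) ^ 4 * (2 * a ^ 2) := by gcongr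
      _ = _ := by field_simp; ring
  have h2 : 4 * E * ((K : ℝ) ^ 2 * a / b) = 4 * ((K : ℝ) ^ 2 * a * b) := by
    rw [hE2]
    field_simp
  linarith

theorem sqrt_mul_sqrt_eq_rpow {a : ℝ} (ha : 0 ≤ a) : √a * √√a = a ^ (3 / 4 : ℝ) := by
  rw [Real.sqrt_eq_rpow, Real.sqrt_eq_rpow, ← Real.rpow_mul ha,
    ← Real.rpow_add_of_nonneg ha (by norm_num) (by norm_num)]
  norm_num

theorem sqrt_sqrt_eq_rpow {a : ℝ} (ha : 0 ≤ a) : √√a = a ^ (1 / 4 : ℝ) := by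
  rw [Real.sqrt_eq_rpow, Real.sqrt_eq_rpow, ← Real.rpow_mul ha]
  norm_num

theorem hedge_rate_le {n t Λ l : ℝ} (hn : 0 ≤ n) (ht : 0 ≤ t) (hΛ : 0 ≤ Λ) (hl : 0 ≤ l) :
    √(n * t) * √(3 * (Λ * √(l * t))) ≤
      2 * (√(n * Λ) * t ^ (3 / 4 : ℝ) * l ^ (1 / 4 : ℝ)) := by
  have h3 : √(3 : ℝ) ≤ 2 := Real.sqrt_le_iff.2 ⟨by norm_num, by norm_num⟩
  rw [← sqrt_mul_sqrt_eq_rpow ht, ← sqrt_sqrt_eq_rpow hl, Real.sqrt_mul hn, Real.sqrt_mul hn,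
    Real.sqrt_mul (by norm_num), Real.sqrt_mul hΛ, Real.sqrt_mul hl,
    Real.sqrt_mul (Real.sqrt_nonneg l)]
  calc √n * √t * (√3 * (√Λ * (√√l * √√t))) = √3 * (√n * √Λ * (√t * √√t) * √√l) := by ring
    _ ≤ 2 * (√n * √Λ * (√t * √√t) * √√l) := by gcongr

theorem ogd_rate_eq {n t B : ℝ} (hn : 0 ≤ n) (ht : 0 ≤ t) (hB : 0 ≤ B) :
    √(n * t) * √(4 * (B * √t)) = 2 * (√(n * B) * t ^ (3 / 4 : ℝ)) := by
  have h4 : √(4 : ℝ) = 2 := by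
    rw [show (4 : ℝ) = 2 ^ 2 by norm_num, Real.sqrt_sq (by norm_num)]
  rw [← sqrt_mul_sqrt_eq_rpow ht, Real.sqrt_mul hn, Real.sqrt_mul hn,
    Real.sqrt_mul (by norm_num), Real.sqrt_mul hB, h4]
  ring

theorem regret_zero {ι X : Type*} [Fintype ι] {N K : ℕ} (O : OnlineOracle ι X N K)
    (σ : (Fin N → ℝ) → (Fin N → ℝ) → Assortment N K → ℝ) (fstar : X → Fin N → ℝ)
    (adv : Adversary X N K) : regret O σ fstar adv 0 = 0 := by
  simp [regret, expectation]

end Tuning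

end MNLBandit

/-! ### The two regret bounds -/

theorem mainTheorem12 :
    (∃ C : ℝ, 0 < C ∧
      ∀ (N K T M : ℕ) (β : ℝ), 1 ≤ K → K ≤ N → 2 ≤ M → 0 < β → β < 1 →
      ∃ γ : ℝ, 0 < γ ∧
      ∀ (X : Type*) (F : Finset (X → Fin N → ℝ)), F.card = M →
      (∀ f ∈ F, ∀ x i, f x i ∈ Set.Icc β 1) →
      ∀ fstar ∈ F,
      ∀ σ : (Fin N → ℝ) → (Fin N → ℝ) → Assortment N K → ℝ, IsLogBarrierStrategy γ σ →
      ∀ adv : Adversary X N K, (∀ h i, (adv h).2 i ∈ Set.Icc (0 : ℝ) 1) →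
      ∀ η : ℝ, η = √(Real.log M / T) / Real.log (K / β) →
        regret (hedgeSample η F) σ fstar adv T ≤
          C * ((K : ℝ) ^ 2 * √(N * Real.log (K / β)) * (T : ℝ) ^ (3 / 4 : ℝ) *
            Real.log M ^ (1 / 4 : ℝ)) ∧
        regret (hedgeMean η F) σ fstar adv T ≤
          C * ((K : ℝ) ^ 2 * √(N * Real.log (K / β)) * (T : ℝ) ^ (3 / 4 : ℝ) *
            Real.log M ^ (1 / 4 : ℝ))) ∧
    (∃ C : ℝ, 0 < C ∧
      ∀ (N K T : ℕ) (B : ℝ), 1 ≤ K → K ≤ N → 0 < B →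
      ∃ γ : ℝ, 0 < γ ∧
      ∀ (d : ℕ) (X : Set (Fin N → EuclideanSpace ℝ (Fin d))), (∀ x ∈ X, ∀ i, ‖x i‖ ≤ 1) →
      ∀ fstar ∈ linearClass B X,
      ∀ σ : (Fin N → ℝ) → (Fin N → ℝ) → Assortment N K → ℝ, IsLogBarrierStrategy γ σ →
      ∀ adv : Adversary X N K, (∀ h i, (adv h).2 i ∈ Set.Icc (0 : ℝ) 1) →
      ∀ θ₁ : EuclideanSpace ℝ (Fin d), ‖θ₁‖ ≤ B →
      ∀ η : ℝ, η = B / √T →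
        regret (ogd η B θ₁ X) σ fstar adv T ≤
          C * ((K : ℝ) ^ 2 * √(N * B) * (T : ℝ) ^ (3 / 4 : ℝ))) := by
  -- The constant is `36 * 2`: 36 from `tunedGamma_bound`, and `√3 ≤ 2` for Hedge or `√4 = 2` for
  -- gradient descent.
  refine ⟨⟨72, by norm_num, fun N K T M β hK hKN hM hβ hβ1 => ?_⟩,
    ⟨72, by norm_num, fun N K T B hK hKN hB => ?_⟩⟩
  · have hK1 : (1 : ℝ) ≤ K := by exact_mod_cast hK
    have hΛ : 0 < Real.log (K / β) := Real.log_pos ((one_lt_div hβ).2 (hβ1.trans_le hK1))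
    have hl : 0 < Real.log M := Real.log_pos (by exact_mod_cast hM)
    rcases Nat.eq_zero_or_pos T with rfl | hT
    -- For `T = 0` the tuned parameter would be 0, but the regret is 0 and any positive `γ` serves.
    · refine ⟨1, one_pos, fun X F _ _ fstar _ σ _ adv _ η _ => ?_⟩
      rw [regret_zero, regret_zero]
      constructor <;> positivity
    have hT0 : (0 : ℝ) < T := by exact_mod_cast hT
    set Λ := Real.log (K / β) with hΛd
    set l := Real.log M with hld
    have hE : 0 < 3 * (Λ * √(l * T)) := by positivity
    refine ⟨tunedGamma N K T (3 * (Λ * √(l * T))), tunedGamma_pos hK hKN hT hE,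
      fun X F hF hFβ fstar hfs σ hσ adv hadv η hη => ?_⟩
    have hγ := tunedGamma_pos hK hKN hT hE
    have hη0 : 0 < η := by rw [hη]; positivity
    obtain ⟨h1, h2⟩ := regret_hedge_le hK hKN hγ hσ hadv hβ hβ1.le hFβ hfs hη0 T
    rw [hF, ← hld] at h1 h2
    have hlogβ : Real.log (1 / β) ≤ Λ := Real.log_le_log (by positivity) (by gcongr)
    have hlogβ0 : 0 ≤ Real.log (1 / β) := Real.log_nonneg ((one_le_div hβ).2 hβ1.le)
    -- With the prescribed `η`, the variance term is at most `2 * Λ * √(l * T)` and the entropy term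
    -- equals `Λ * √(l * T)`.
    have hE2 : T * (η * (2 * Real.log (1 / β)) ^ 2 / 2) + l / η ≤ 3 * (Λ * √(l * T)) := by
      calc T * (η * (2 * Real.log (1 / β)) ^ 2 / 2) + l / η
          ≤ T * (η * (2 * Λ) ^ 2 / 2) + l / η := by gcongr
        _ = 3 * (Λ * √(l * T)) := by
          have hsl : 0 < √l := Real.sqrt_pos.2 hl
          have hsT : 0 < √(T : ℝ) := Real.sqrt_pos.2 hT0
          have e1 : l = √l ^ 2 := (Real.sq_sqrt hl.le).symm
          have e2 : (T : ℝ) = √(T : ℝ) ^ 2 := (Real.sq_sqrt hT0.le).symm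
          rw [hη, Real.sqrt_div hl.le, Real.sqrt_mul hl.le]
          generalize √l = a at *
          generalize √(T : ℝ) = b at *
          rw [e1, e2]
          field_simp
          ring
    have hfin : 2 * ((K : ℝ) + 1) ^ 4 * N * T / tunedGamma N K T (3 * (Λ * √(l * T))) +
        4 * (T * (η * (2 * Real.log (1 / β)) ^ 2 / 2) + l / η) *
          tunedGamma N K T (3 * (Λ * √(l * T))) ≤
        72 * ((K : ℝ) ^ 2 * √(N * Λ) * (T : ℝ) ^ (3 / 4 : ℝ) * l ^ (1 / 4 : ℝ)) := by
      have h3 := tunedGamma_bound hK hKN hT hE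
      have h4 := mul_le_mul_of_nonneg_left
        (hedge_rate_le N.cast_nonneg hT0.le hΛ.le hl.le) (sq_nonneg (K : ℝ))
      have h5 := mul_le_mul_of_nonneg_right hE2 hγ.le
      linarith
    exact ⟨h1.trans hfin, h2.trans hfin⟩
  · rcases Nat.eq_zero_or_pos T with rfl | hT
    · refine ⟨1, one_pos, fun d X _ fstar _ σ _ adv _ θ₁ _ η _ => ?_⟩
      rw [regret_zero]
      positivity
    have hT0 : (0 : ℝ) < T := by exact_mod_cast hT
    have hE : 0 < 4 * (B * √(T : ℝ)) := by positivity
    have hγ := tunedGamma_pos hK hKN hT hE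
    refine ⟨tunedGamma N K T (4 * (B * √(T : ℝ))), hγ,
      fun d X hX fstar hfs σ hσ adv hadv θ₁ hθ₁ η hη => ?_⟩
    have hη0 : 0 < η := by rw [hη]; positivity
    have h1 := regret_ogd_le hK hKN hγ hσ hX hadv hη0 hB.le hθ₁ hfs T
    -- At `η = B / √T` the two terms are equal.
    have hE2 : T * (2 * η) + 2 * B ^ 2 / η = 4 * (B * √(T : ℝ)) := by
      have hsT : 0 < √(T : ℝ) := Real.sqrt_pos.2 hT0
      have e2 : (T : ℝ) = √(T : ℝ) ^ 2 := (Real.sq_sqrt hT0.le).symm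
      rw [hη]
      generalize √(T : ℝ) = b at *
      rw [e2]
      field_simp
      ring
    rw [hE2] at h1
    have h3 := tunedGamma_bound hK hKN hT hE
    rw [mul_assoc ((K : ℝ) ^ 2), ogd_rate_eq N.cast_nonneg hT0.le hB.le] at h3
    linarith
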